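/- Let $D>0$ and $R>\sqrt3\,D$. Let $A,B:\mathbb R^3\to[0,\infty)$ be smooth functions supported in $[-D,D]^3$. For each $n\ge 1$ subdivide $[-D,D]^3$ into the $(2n)^3$ boxes of side length $D/n$, and let $p_{i,n}$ denote their centres. Let $\alpha_{i,n},\beta_{i,n}\ge 0$ be parameters with $$\mathscr C(\alpha,A):=\sup_{i,n} n^4\left|\alpha_{i,n}-A(p_{i,n})(D/n)^3\right|<\infty,\qquad \mathscr C(\beta,B):=\sup_{i,n} n^4\left|\beta_{i,n}-B(p_{i,n})(D/n)^3\right|<\infty .$$ Put $$\chi_n(x)=1+\sum_i\frac{\alpha_{i,n}}{|x-p_{i,n}|},\quad \psi_n(x)=1+\sum_i\frac{\beta_{i,n}}{|x-p_{i,n}|},\quad \chi(x)=1+\int_{\mathbb R^3}\frac{A(y)}{|x-y|}\,dy,\quad \psi(x)=1+\int_{\mathbb R^3}\frac{B(y)}{|x-y|}\,dy,$$ let $g_{\mathbb E}$ be the Euclidean metric, and let $g_n=(\chi_n\psi_n)^2g_{\mathbb E}$ and $g=(\chi\psi)^2g_{\mathbb E}$. Let $$\mathcal U_{n,R}=B(0,R)\smallsetminus\bigcup_i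 B\!\left(p_{i,n},\tfrac{D}{n^2}\right),$$ where all balls are open Euclidean balls. For a set $U$ and a metric $h$ let $d_{(U,h)}(x,y)$ be the infimum of the $h$-lengths of piecewise smooth paths in $U$ from $x$ to $y$; $(U,h)$ stands for $U$ with this distance. Let $d^{GH}$ be the Gromov–Hausdorff distance, i.e. the infimum of the Hausdorff distances of the images under distance preserving maps into a common metric space (compactness is not required). Then $(\mathcal U_{n,R},g_n)$ converges in the Gromov–Hausdorff sense to $(B(0,R),g)$ as $n\to\infty$. Moreover, for all $n\ge 1$, $$d^{GH}\big((\mathcal U_{n,R},g_n),(B(0,R),g)\big)\le \frac{C}{n},$$ where $C$ is a polynomial in $R$ whose coefficients are polynomials in $\|A\|D^2$, $\|B\|D^2$, $\|dA\|D^3$, $\|dB\|D^3$, $\mathscr C(\alpha,A)/D$ and $\mathscr C(\beta,B)/D$ with universal non-negative real coefficients (the same for all $D,R,A,B,\alpha,\beta$); the norms are Euclidean $L^\infty(\mathbb R^3)$-norms. -/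

import Mathlib

open MeasureTheory Set Filter Topology
open scoped ENNReal NNReal ContDiff

noncomputable section

namespace BrillLindquist

/-- Euclidean three-space. -/
abbrev E3 : Type := EuclideanSpace ℝ (Fin 3)

/-! ### Riemannian length and distance on subsets of Euclidean space -/

/-- The restriction of `γ` to `[0, 1]` is piecewise smooth: up to a finite set `S` of break points,
it is smooth, up to and including the endpoints, on every compact subinterval of `[0, 1]` without
break points in its interior. (This forces continuity on `[0, 1]`.) -/
def IsPiecewiseSmooth (γ : ℝ → E3) : Prop :=
  ∃ S : Finset ℝ, ∀ a b : ℝ, 0 ≤ a → a < b → b ≤ 1 → Disjoint (Ioo a b) (S : Set ℝ) →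
    ContDiffOn ℝ ∞ γ (Icc a b)

/-- The Riemannian metric `u² g_𝔼`, evaluated at the base point `x` on the vectors `v`, `w`. -/
def conformalMetric (u : E3 → ℝ) (x v w : E3) : ℝ :=
  u x ^ 2 * inner ℝ v w

/-- The length `∫₀¹ √(g(γ', γ')) dt` of `γ : [0, 1] → ℝ³` for a metric `g`. -/
def pathLength (g : E3 → E3 → E3 → ℝ) (γ : ℝ → E3) : ℝ≥0∞ :=
  ∫⁻ t in Icc (0 : ℝ) 1, ENNReal.ofReal √(g (γ t) (deriv γ t) (deriv γ t))

/-- The distance `d_{(U, g)}(x, y)`: the infimum of the `g`-lengths of the piecewise smooth paths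
from `x` to `y` that stay in `U` (and `∞` if there are none). -/
def intrinsicDist (U : Set E3) (g : E3 → E3 → E3 → ℝ) (x y : U) : ℝ≥0∞ :=
  ⨅ (γ : ℝ → E3) (_ : IsPiecewiseSmooth γ) (_ : MapsTo γ (Icc 0 1) U)
    (_ : γ 0 = x) (_ : γ 1 = y), pathLength g γ

/-! ### The Gromov–Hausdorff distance -/

/-- The Gromov–Hausdorff distance of `(X, dX)` and `(Y, dY)`: the infimum of the Hausdorff distances
of the images of `X` and `Y`, over all distance preserving maps of `X` and `Y` into a common metric
space `Z`. Compactness is not required. If `dX` or `dY` is not a (finite) metric up to points at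
distance zero, then there are no such maps, and the value is `∞`. -/
def ghDist {X Y : Type} (dX : X → X → ℝ≥0∞) (dY : Y → Y → ℝ≥0∞) : ℝ≥0∞ :=
  ⨅ (Z : Type) (_ : MetricSpace Z) (Φ : X → Z) (Ψ : Y → Z)
    (_ : ∀ x x', edist (Φ x) (Φ x') = dX x x') (_ : ∀ y y', edist (Ψ y) (Ψ y') = dY y y'),
    Metric.hausdorffEDist (range Φ) (range Ψ)

/-! ### Brill–Lindquist–Riemann sums -/

/-- The box `[-D, D]³`. -/
def box (D : ℝ) : Set E3 := {x | ∀ j, x j ∈ Icc (-D) D}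

/-- Indices of the `(2n)³` boxes of side `D / n` that subdivide `[-D, D]³`. -/
abbrev Index (n : ℕ) : Type := Fin 3 → Fin (2 * n)

/-- The centre `p_{i,n}` of the box with index `i`; its `j`-th coordinate is `(k + 1/2) D / n`
with `k = i j - n`, an integer with `-n ≤ k < n`. -/
def boxCenter (D : ℝ) (n : ℕ) (i : Index n) : E3 :=
  WithLp.toLp 2 fun j => (((i j : ℕ) : ℝ) - (n : ℝ) + 1 / 2) / (n : ℝ) * D

/-- A smooth non-negative function supported in `[-D, D]³`. -/
structure IsDensity (D : ℝ) (A : E3 → ℝ) : Prop where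
  smooth : ContDiff ℝ ∞ A
  nonneg : ∀ x, 0 ≤ A x
  support_subset : Function.support A ⊆ box D

/-- The numbers `n⁴ |α_{i,n} - A(p_{i,n}) (D/n)³|`, over all `n ≥ 1` and all `i` (there are no
indices `i` for `n = 0`). -/
def sampleErrors (D : ℝ) (A : E3 → ℝ) (α : (n : ℕ) → Index n → ℝ) (k : Σ n : ℕ, Index n) : ℝ :=
  (k.1 : ℝ) ^ 4 * |α k.1 k.2 - A (boxCenter D k.1 k.2) * (D / (k.1 : ℝ)) ^ 3|

/-- The constant `𝒞(α, A) = sup_{i,n} n⁴ |α_{i,n} - A(p_{i,n}) (D/n)³|`. -/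
def sampleConst (D : ℝ) (A : E3 → ℝ) (α : (n : ℕ) → Index n → ℝ) : ℝ :=
  ⨆ k, sampleErrors D A α k

/-- Admissible parameters for `A`: they are non-negative and `𝒞(α, A) < ∞`. -/
structure IsAdmissible (D : ℝ) (A : E3 → ℝ) (α : (n : ℕ) → Index n → ℝ) : Prop where
  nonneg : ∀ n i, 0 ≤ α n i
  bddAbove : BddAbove (range (sampleErrors D A α))

/-- The factor `1 + ∑_i α_{i,n} / |x - p_{i,n}|`. -/
def discreteFactor (D : ℝ) (α : (n : ℕ) → Index n → ℝ) (n : ℕ) (x : E3) : ℝ :=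
  1 + ∑ i : Index n, α n i / ‖x - boxCenter D n i‖

/-- The factor `1 + ∫ A(y) / |x - y| dy`. -/
def limitFactor (A : E3 → ℝ) (x : E3) : ℝ :=
  1 + ∫ y : E3, A y / ‖x - y‖

/-- The Brill–Lindquist–Riemann metric `g_n = (χ_n ψ_n)² g_𝔼`. -/
def discreteMetric (D : ℝ) (α β : (n : ℕ) → Index n → ℝ) (n : ℕ) : E3 → E3 → E3 → ℝ :=
  conformalMetric fun x => discreteFactor D α n x * discreteFactor D β n x

/-- The dust cloud metric `g = (χ ψ)² g_𝔼`. -/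
def limitMetric (A B : E3 → ℝ) : E3 → E3 → E3 → ℝ :=
  conformalMetric fun x => limitFactor A x * limitFactor B x

/-- The perforated ball `U_{n,R} = B(0, R) ∖ ⋃_i B(p_{i,n}, D / n²)`. -/
def perforatedBall (D R : ℝ) (n : ℕ) : Set E3 :=
  Metric.ball 0 R \ ⋃ i : Index n, Metric.ball (boxCenter D n i) (D / (n : ℝ) ^ 2)

/-! ### Control constants -/

/-- The sup norm `‖A‖` of a function. -/
def supNorm (A : E3 → ℝ) : ℝ := ⨆ x, |A x|

/-- The sup norm `‖dA‖` of the differential of a function. -/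
def supNormDeriv (A : E3 → ℝ) : ℝ := ⨆ x, ‖fderiv ℝ A x‖

/-- The six control variables `‖A‖D²`, `‖B‖D²`, `‖dA‖D³`, `‖dB‖D³`, `𝒞(α, A)/D`, `𝒞(β, B)/D`. -/
def controlVars (D : ℝ) (A B : E3 → ℝ) (α β : (n : ℕ) → Index n → ℝ) : Fin 6 → ℝ :=
  ![supNorm A * D ^ 2, supNorm B * D ^ 2, supNormDeriv A * D ^ 3, supNormDeriv B * D ^ 3,
    sampleConst D A α / D, sampleConst D B β / D]

/-- Universal recipes for constants of class `𝒞⁺[R]`: polynomials in one variable `R` whose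
coefficients are polynomials, with non-negative real coefficients, in six control variables. -/
abbrev ControlPoly : Type := Polynomial (MvPolynomial (Fin 6) ℝ≥0)

/-- The value of such a polynomial at given control variables and a given `R`. -/
def ControlPoly.value (P : ControlPoly) (c : Fin 6 → ℝ) (R : ℝ) : ℝ :=
  P.eval₂ (MvPolynomial.eval₂Hom NNReal.toRealHom c) R

end BrillLindquist

end

namespace BrillLindquist

/-! ### Piecewise smooth paths -/

/-! Write `u` for the limit factor χψ and `v` for the discrete factor χₙψₙ. All that is used about
them is a number `Λ ≥ 1`, polynomial in the control variables, such that `1 ≤ u ≤ Λ`, `u` has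
Lipschitz constant `Λ / D`, and on the perforated ball `1 ≤ v ≤ Λ` and `|v - u| ≤ Λ / n`.

These bounds are potential theory. The Newton kernel and its square are integrable over the box,
uniformly in the pole. Comparing `v` with `u` is a Riemann sum estimate
(`abs_discreteFactor_sub_limitFactor_le`): away from the pole the kernel varies by a multiple of `(D
/ n) / |x - y|²`; near the pole, the holes bound the discrete kernel by `n² / D` on a region of
volume of order `(D / n)³`. Both contributions are `O(1 / n)`.

The inclusion of the perforated ball into the ball is then almost an isometry. A path in the
perforated ball has `u`-length at most `1 + Λ / n` times its `v`-length
(`intrinsicDist_ball_le_mul`), and bounded diameters make this an additive error. Conversely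
(`intrinsicDist_perforatedBall_le_add`), cut a path in the ball into pieces of `u`-length `D /
(8n)`, push the cut points out of the holes, and replace each piece by a segment with a detour
around the at most one hole in its way. A detour costs `O(Λ D / n²)` and there are `O(n L / D)`
pieces for a path of length `L`, where only `L < 4RΛ` matters; the total is `O(Λ² R / n)`. A gluing
of the two spaces along the inclusion turns this into a Gromov–Hausdorff bound
(`ghDist_le_of_approx`).

For `n < 16` the claimed bound exceeds the diameters, so only diameter bounds are needed. For `n ≥
2` the holes are essentially disjoint and detours along their boundary spheres suffice. For `n = 1`
the eight holes overlap, and connectedness with a diameter bound is proved by explicit paths through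
the coordinate axes (`intrinsicDist_perforatedBall_one_le`); this is where room outside the holes,
provided by `R > √3 D`, is used most delicately. -/

/-- The conformal speed of a path. -/
noncomputable def speed (u : E3 → ℝ) (γ : ℝ → E3) (t : ℝ) : ℝ≥0∞ :=
  ENNReal.ofReal (|u (γ t)| * ‖deriv γ t‖)

lemma sqrt_conformalMetric (u : E3 → ℝ) (x v : E3) :
    √(conformalMetric u x v v) = |u x| * ‖v‖ := by
  rw [conformalMetric, real_inner_self_eq_norm_sq, ← mul_pow, Real.sqrt_sq_eq_abs, abs_mul,
    abs_norm]

lemma pathLength_conformalMetric (u : E3 → ℝ) (γ : ℝ → E3) :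
    pathLength (conformalMetric u) γ = ∫⁻ t in Ioo (0 : ℝ) 1, speed u γ t := by
  simp only [pathLength, sqrt_conformalMetric]
  exact (setLIntegral_congr Ioo_ae_eq_Icc).symm

lemma IsPiecewiseSmooth.of_contDiffOn {γ : ℝ → E3} (h : ContDiffOn ℝ ∞ γ (Icc 0 1)) :
    IsPiecewiseSmooth γ :=
  ⟨∅, fun _ _ ha _ hb _ => h.mono (Icc_subset_Icc ha hb)⟩

lemma exists_pos_forall_notMem (S : Finset ℝ) (t : ℝ) :
    ∃ ε > 0, ∀ s, |s - t| < ε → s ≠ t → s ∉ S := by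
  have h : ((S : Set ℝ) \ {t})ᶜ ∈ 𝓝 t :=
    (S.finite_toSet.subset sdiff_subset).isClosed.isOpen_compl.mem_nhds (by simp)
  obtain ⟨ε, hε, hs⟩ := Metric.mem_nhds_iff.1 h
  refine ⟨ε, hε, fun s h1 h2 h3 => ?_⟩
  exact hs (show s ∈ Metric.ball t ε by rwa [Metric.mem_ball, Real.dist_eq]) ⟨h3, h2⟩

/-- Break points are isolated, so on either side of `t` a short interval ending at `t` has none in
its interior. Smoothness up to the endpoint gives one-sided continuity even when `t` itself is a
break point. -/
lemma IsPiecewiseSmooth.continuousOn {γ : ℝ → E3} (h : IsPiecewiseSmooth γ) :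
    ContinuousOn γ (Icc 0 1) := by
  obtain ⟨S, hS⟩ := h
  intro t ht
  obtain ⟨ε, hε, hε'⟩ := exists_pos_forall_notMem S t
  have hl : ContinuousWithinAt γ (Icc 0 t) t := by
    rcases eq_or_lt_of_le ht.1 with h0 | h0
    · rw [← h0, Icc_self]; exact continuousWithinAt_singleton
    · have hlt : max 0 (t - ε) < t := max_lt h0 (by linarith)
      have hc := (hS (max 0 (t - ε)) t (le_max_left _ _) hlt ht.2 (by
        rw [Set.disjoint_left]
        rintro s ⟨h1, h2⟩
        have := (le_max_right 0 (t - ε)).trans_lt h1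
        exact hε' s (by rw [abs_lt]; constructor <;> linarith) h2.ne)).continuousOn t
          ⟨hlt.le, le_rfl⟩
      refine hc.mono_of_mem_nhdsWithin ?_
      exact mem_of_superset (inter_mem_nhdsWithin _ (Ioi_mem_nhds hlt))
        fun s hs => ⟨le_of_lt hs.2, hs.1.2⟩
  have hr : ContinuousWithinAt γ (Icc t 1) t := by
    rcases eq_or_lt_of_le ht.2 with h0 | h0
    · rw [h0, Icc_self]; exact continuousWithinAt_singleton
    · have hlt : t < min 1 (t + ε) := lt_min h0 (by linarith)
      have hc := (hS t (min 1 (t + ε)) ht.1 hlt (min_le_left _ _) (by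
        rw [Set.disjoint_left]
        rintro s ⟨h1, h2⟩
        have := h2.trans_le (min_le_right 1 (t + ε))
        exact hε' s (by rw [abs_lt]; constructor <;> linarith) h1.ne')).continuousOn t
          ⟨le_rfl, hlt.le⟩
      refine hc.mono_of_mem_nhdsWithin ?_
      exact mem_of_superset (inter_mem_nhdsWithin _ (Iio_mem_nhds hlt))
        fun s hs => ⟨hs.1.1, le_of_lt hs.2⟩
  refine (hl.union hr).mono fun s hs => ?_
  rcases le_total s t with h | h
  · exact Or.inl ⟨hs.1, h⟩
  · exact Or.inr ⟨h, hs.2⟩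

lemma IsPiecewiseSmooth.exists_differentiableAt {γ : ℝ → E3} (h : IsPiecewiseSmooth γ) :
    ∃ S : Finset ℝ, ∀ t ∈ Ioo (0 : ℝ) 1, t ∉ S → DifferentiableAt ℝ γ t := by
  obtain ⟨S, hS⟩ := h
  refine ⟨S, fun t ht htS => ?_⟩
  obtain ⟨ε, hε, hε'⟩ := exists_pos_forall_notMem S t
  have h1 : max 0 (t - ε) < t := max_lt ht.1 (by linarith)
  have h2 : t < min 1 (t + ε) := lt_min ht.2 (by linarith)
  have := hS _ _ (le_max_left 0 (t - ε)) (h1.trans h2) (min_le_left 1 (t + ε)) (by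
    rw [Set.disjoint_left]
    rintro s ⟨h3, h4⟩ hs
    have h5 := (le_max_right 0 (t - ε)).trans_lt h3
    have h6 := h4.trans_le (min_le_right 1 (t + ε))
    by_cases hst : s = t
    · exact htS (hst ▸ hs)
    · exact hε' s (by rw [abs_lt]; constructor <;> linarith) hst hs)
  exact (this.differentiableOn (by simp)).differentiableAt (Icc_mem_nhds h1 h2)

/-- The Euclidean distance is bounded by the Euclidean length. -/
lemma IsPiecewiseSmooth.enorm_sub_le {γ : ℝ → E3} (h : IsPiecewiseSmooth γ) {a b : ℝ}
    (ha : 0 ≤ a) (hab : a ≤ b) (hb : b ≤ 1) :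
    ‖γ b - γ a‖ₑ ≤ ∫⁻ t in Ioo a b, ‖deriv γ t‖ₑ := by
  by_cases hfin : ∫⁻ t in Ioo a b, ‖deriv γ t‖ₑ = ⊤
  · simp [hfin]
  obtain ⟨S, hS⟩ := h.exists_differentiableAt
  have hint : IntervalIntegrable (deriv γ) volume a b := by
    rw [intervalIntegrable_iff_integrableOn_Ioo_of_le hab]
    exact ⟨(stronglyMeasurable_deriv γ).aestronglyMeasurable,
      lt_top_iff_ne_top.2 hfin⟩
  have := integral_eq_of_hasDerivAt_off_countable_of_le γ (deriv γ) hab S.countable_toSet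
    (h.continuousOn.mono (Icc_subset_Icc ha hb))
    (fun x hx => (hS x ⟨ha.trans_lt hx.1.1, hx.1.2.trans_le hb⟩ hx.2).hasDerivAt) hint
  rw [← this, intervalIntegral.integral_of_le hab]
  refine (enorm_integral_le_lintegral_enorm _).trans (le_of_eq ?_)
  exact (setLIntegral_congr Ioo_ae_eq_Ioc).symm

/-- The chain rule factor `|c|` is the Jacobian of the substitution. Keeping the domain as an image
covers `c < 0`, needed for reversal, together with `c > 0`, needed for concatenation. -/
lemma lintegral_speed_affine (u : E3 → ℝ) {γ γ' : ℝ → E3} {a b c d : ℝ} (hc : c ≠ 0)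
    (h : ∀ t ∈ Ioo a b, γ' t = γ (c * t + d)) :
    ∫⁻ t in Ioo a b, speed u γ' t = ∫⁻ t in (fun t => c * t + d) '' Ioo a b, speed u γ t := by
  have hd (x : ℝ) : HasDerivAt (fun t => c * t + d) c x := by
    simpa using ((hasDerivAt_id x).const_mul c).add_const d
  rw [lintegral_image_eq_lintegral_abs_deriv_mul measurableSet_Ioo (f' := fun _ => c)
    (fun x _ => (hd x).hasDerivWithinAt) (fun x _ y _ hxy => by simpa [hc] using hxy)]
  refine setLIntegral_congr_fun measurableSet_Ioo fun t ht => ?_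
  have hd : deriv γ' t = c • deriv γ (c * t + d) := by
    have he : γ' =ᶠ[𝓝 t] fun s => (fun x => γ (x + d)) (c * s) := by
      filter_upwards [Ioo_mem_nhds ht.1 ht.2] with s hs using h s hs
    rw [he.deriv_eq, deriv_comp_mul_left c (fun x => γ (x + d)) t,
      deriv_comp_add_const γ d (c * t)]
  simp only [speed]
  rw [← ENNReal.ofReal_mul (abs_nonneg _), hd, h t ht, norm_smul, Real.norm_eq_abs]
  congr 1
  ring

/-- The concatenation of two paths. -/
noncomputable def concat (γ₁ γ₂ : ℝ → E3) (t : ℝ) : E3 :=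
  if t ≤ 1 / 2 then γ₁ (2 * t) else γ₂ (2 * t - 1)

lemma concat_of_le {γ₁ γ₂ : ℝ → E3} {t : ℝ} (ht : t ≤ 1 / 2) :
    concat γ₁ γ₂ t = γ₁ (2 * t) := if_pos ht

lemma concat_of_ge {γ₁ γ₂ : ℝ → E3} (h : γ₁ 1 = γ₂ 0) {t : ℝ} (ht : 1 / 2 ≤ t) :
    concat γ₁ γ₂ t = γ₂ (2 * t + (-1)) := by
  rcases eq_or_lt_of_le ht with rfl | h'
  · rw [concat_of_le le_rfl]; norm_num [h]
  · exact (if_neg (not_le.2 h')).trans (by rw [sub_eq_add_neg])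

lemma contDiffOn_comp_affine {γ : ℝ → E3} {a b c d a' b' : ℝ} (h : ContDiffOn ℝ ∞ γ (Icc a b))
    (hm : ∀ t ∈ Icc a' b', c * t + d ∈ Icc a b) :
    ContDiffOn ℝ ∞ (fun t => γ (c * t + d)) (Icc a' b') :=
  h.comp (f := fun t => c * t + d) (by fun_prop) hm

lemma IsPiecewiseSmooth.concat {γ₁ γ₂ : ℝ → E3} (h₁ : IsPiecewiseSmooth γ₁)
    (h₂ : IsPiecewiseSmooth γ₂) (h : γ₁ 1 = γ₂ 0) : IsPiecewiseSmooth (concat γ₁ γ₂) := by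
  classical
  obtain ⟨S, hS⟩ := h₁
  obtain ⟨T, hT⟩ := h₂
  refine ⟨S.image (fun s => s / 2) ∪ T.image (fun s => (s + 1) / 2) ∪ {1 / 2},
    fun a b ha hab hb hd => ?_⟩
  rw [Set.disjoint_left] at hd
  have h12 : b ≤ 1 / 2 ∨ 1 / 2 ≤ a := by
    by_contra! hc
    exact hd ⟨hc.2, hc.1⟩ (by simp)
  rcases h12 with hb' | ha'
  · have := hS (2 * a) (2 * b) (by linarith) (by linarith) (by linarith) (by
      rw [Set.disjoint_left]
      rintro s ⟨h1, h2⟩ hs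
      refine hd (a := s / 2) ⟨by linarith, by linarith⟩ ?_
      simp only [Finset.coe_union, Finset.coe_image, mem_union, mem_image]
      exact Or.inl (Or.inl ⟨s, hs, rfl⟩))
    refine (contDiffOn_comp_affine (c := 2) (d := 0) (a' := a) (b' := b) this
      fun t ht => ⟨by linarith [ht.1], by linarith [ht.2]⟩).congr fun t ht => ?_
    rw [concat_of_le (ht.2.trans hb'), add_zero]
  · have := hT (2 * a - 1) (2 * b - 1) (by linarith) (by linarith) (by linarith) (by
      rw [Set.disjoint_left]
      rintro s ⟨h1, h2⟩ hs
      refine hd (a := (s + 1) / 2) ⟨by linarith, by linarith⟩ ?_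
      simp only [Finset.coe_union, Finset.coe_image, mem_union, mem_image]
      exact Or.inl (Or.inr ⟨s, hs, rfl⟩))
    refine (contDiffOn_comp_affine (c := 2) (d := -1) (a' := a) (b' := b) this
      fun t ht => ⟨by linarith [ht.1], by linarith [ht.2]⟩).congr fun t ht => ?_
    rw [concat_of_ge h (ha'.trans ht.1)]

lemma image_affine_Ioo_subset {a b c d a' b' : ℝ} (h : ∀ t ∈ Ioo a b, c * t + d ∈ Ioo a' b') :
    (fun t => c * t + d) '' Ioo a b ⊆ Ioo a' b' := by
  rintro _ ⟨t, ht, rfl⟩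
  exact h t ht

lemma pathLength_concat_le (u : E3 → ℝ) {γ₁ γ₂ : ℝ → E3} (h : γ₁ 1 = γ₂ 0) :
    pathLength (conformalMetric u) (concat γ₁ γ₂) ≤
      pathLength (conformalMetric u) γ₁ + pathLength (conformalMetric u) γ₂ := by
  simp only [pathLength_conformalMetric]
  have hu : Ioo (0 : ℝ) 1 ⊆ Ioc 0 (1 / 2) ∪ Ioo (1 / 2) 1 := fun t ht => by
    rcases le_or_gt t (1 / 2) with h | h
    · exact Or.inl ⟨ht.1, h⟩
    · exact Or.inr ⟨h, ht.2⟩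
  refine (lintegral_mono_set hu).trans ((lintegral_union_le _ _ _).trans (add_le_add ?_ ?_))
  · rw [← setLIntegral_congr Ioo_ae_eq_Ioc, lintegral_speed_affine u (c := 2) (d := 0)
      two_ne_zero fun t ht => by rw [concat_of_le ht.2.le, add_zero]]
    exact lintegral_mono_set (image_affine_Ioo_subset fun t ht =>
      ⟨by linarith [ht.1], by linarith [ht.2]⟩)
  · rw [lintegral_speed_affine u (c := 2) (d := -1)
      two_ne_zero fun t ht => concat_of_ge h ht.1.le]
    exact lintegral_mono_set (image_affine_Ioo_subset fun t ht =>
      ⟨by linarith [ht.1], by linarith [ht.2]⟩)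

lemma IsPiecewiseSmooth.reverse {γ : ℝ → E3} (h : IsPiecewiseSmooth γ) :
    IsPiecewiseSmooth fun t => γ (-1 * t + 1) := by
  classical
  obtain ⟨S, hS⟩ := h
  refine ⟨S.image fun s => 1 - s, fun a b ha hab hb hd => ?_⟩
  rw [Set.disjoint_left] at hd
  have := hS (1 - b) (1 - a) (by linarith) (by linarith) (by linarith) (by
      rw [Set.disjoint_left]
      rintro s ⟨h1, h2⟩ hs
      refine hd (a := 1 - s) ⟨by linarith, by linarith⟩ ?_
      simpa using hs)
  exact contDiffOn_comp_affine this fun t ht => ⟨by linarith [ht.2], by linarith [ht.1]⟩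

lemma pathLength_reverse_le (u : E3 → ℝ) (γ : ℝ → E3) :
    pathLength (conformalMetric u) (fun t => γ (-1 * t + 1)) ≤
      pathLength (conformalMetric u) γ := by
  simp only [pathLength_conformalMetric]
  rw [lintegral_speed_affine u (c := -1) (d := 1) (by norm_num) fun t _ => rfl]
  exact lintegral_mono_set (image_affine_Ioo_subset fun t ht =>
      ⟨by linarith [ht.2], by linarith [ht.1]⟩)

/-! ### The intrinsic distance -/

lemma intrinsicDist_le_pathLength {U : Set E3} {g : E3 → E3 → E3 → ℝ} {x y : U} {γ : ℝ → E3}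
    (h : IsPiecewiseSmooth γ) (hU : MapsTo γ (Icc 0 1) U) (h0 : γ 0 = x) (h1 : γ 1 = y) :
    intrinsicDist U g x y ≤ pathLength g γ :=
  iInf_le_of_le γ (iInf_le_of_le h (iInf_le_of_le hU (iInf_le_of_le h0 (iInf_le_of_le h1 le_rfl))))

lemma le_intrinsicDist {U : Set E3} {g : E3 → E3 → E3 → ℝ} {x y : U} {c : ℝ≥0∞}
    (h : ∀ γ : ℝ → E3, IsPiecewiseSmooth γ → MapsTo γ (Icc 0 1) U → γ 0 = x → γ 1 = y →
      c ≤ pathLength g γ) :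
    c ≤ intrinsicDist U g x y :=
  le_iInf fun γ => le_iInf fun h1 => le_iInf fun h2 => le_iInf fun h3 => le_iInf fun h4 =>
    h γ h1 h2 h3 h4

lemma intrinsicDist_comm (U : Set E3) (u : E3 → ℝ) (x y : U) :
    intrinsicDist U (conformalMetric u) x y = intrinsicDist U (conformalMetric u) y x := by
  have key : ∀ x y : U, intrinsicDist U (conformalMetric u) x y ≤
      intrinsicDist U (conformalMetric u) y x := fun x y =>
    le_intrinsicDist fun γ h1 h2 h3 h4 =>
      (intrinsicDist_le_pathLength h1.reverse
        (fun t ht => h2 ⟨by linarith [ht.2], by linarith [ht.1]⟩)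
        (by simpa using h4) (by simpa using h3)).trans (pathLength_reverse_le u γ)
  exact le_antisymm (key x y) (key y x)

lemma intrinsicDist_triangle (U : Set E3) (u : E3 → ℝ) (x y z : U) :
    intrinsicDist U (conformalMetric u) x z ≤
      intrinsicDist U (conformalMetric u) x y + intrinsicDist U (conformalMetric u) y z := by
  have key : ∀ γ : ℝ → E3, IsPiecewiseSmooth γ → MapsTo γ (Icc 0 1) U → γ 0 = x → γ 1 = y →
      intrinsicDist U (conformalMetric u) x z ≤ pathLength (conformalMetric u) γ +
        intrinsicDist U (conformalMetric u) y z := by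
    intro γ h1 h2 h3 h4
    rw [← tsub_le_iff_left]
    refine le_intrinsicDist fun γ' h1' h2' h3' h4' => ?_
    rw [tsub_le_iff_left]
    have h : γ 1 = γ' 0 := by rw [h4, h3']
    refine (intrinsicDist_le_pathLength (h1.concat h1' h) (fun t ht => ?_) ?_ ?_).trans
      (pathLength_concat_le u h)
    · rcases le_total t (1 / 2) with h' | h'
      · rw [concat_of_le h']; exact h2 ⟨by linarith [ht.1], by linarith⟩
      · rw [concat_of_ge h h']; exact h2' ⟨by linarith, by linarith [ht.2]⟩
    · rw [concat_of_le (by norm_num)]; simpa using h3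
    · rw [concat_of_ge h (by norm_num)]; norm_num [h4']
  rw [← tsub_le_iff_right]
  refine le_intrinsicDist fun γ h1 h2 h3 h4 => ?_
  rw [tsub_le_iff_right]
  exact key γ h1 h2 h3 h4

lemma intrinsicDist_self (U : Set E3) (u : E3 → ℝ) (x : U) :
    intrinsicDist U (conformalMetric u) x x = 0 := by
  refine le_antisymm ?_ zero_le
  refine (intrinsicDist_le_pathLength (γ := fun _ => (x : E3))
    (.of_contDiffOn contDiffOn_const) (fun t _ => x.2) rfl rfl).trans (le_of_eq ?_)
  simp [pathLength_conformalMetric, speed]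

/-- As `u ≥ 1`, conformal length dominates Euclidean length. This makes the intrinsic distance
definite. -/
lemma enorm_sub_le_intrinsicDist {U : Set E3} {u : E3 → ℝ} (hu : ∀ x ∈ U, 1 ≤ u x) (x y : U) :
    ‖(y : E3) - x‖ₑ ≤ intrinsicDist U (conformalMetric u) x y := by
  refine le_intrinsicDist fun γ h1 h2 h3 h4 => ?_
  have := h1.enorm_sub_le le_rfl zero_le_one le_rfl
  rw [h3, h4] at this
  rw [pathLength_conformalMetric]
  refine this.trans (setLIntegral_mono' measurableSet_Ioo fun t ht => ?_)
  rw [speed, ← ofReal_norm]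
  refine ENNReal.ofReal_le_ofReal (le_mul_of_one_le_left (norm_nonneg _) ?_)
  exact (hu _ (h2 ⟨ht.1.le, ht.2.le⟩)).trans (le_abs_self _)

lemma intrinsicDist_le_of_norm_deriv_le {U : Set E3} {u : E3 → ℝ} {x y : U} {γ : ℝ → E3}
    (h : IsPiecewiseSmooth γ) (hU : MapsTo γ (Icc 0 1) U) (h0 : γ 0 = x) (h1 : γ 1 = y) {V l : ℝ}
    (hV : ∀ t ∈ Icc (0 : ℝ) 1, |u (γ t)| ≤ V) (hl : ∀ t ∈ Ioo (0 : ℝ) 1, ‖deriv γ t‖ ≤ l) :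
    intrinsicDist U (conformalMetric u) x y ≤ ENNReal.ofReal (V * l) := by
  refine (intrinsicDist_le_pathLength h hU h0 h1).trans ?_
  rw [pathLength_conformalMetric]
  calc ∫⁻ t in Ioo (0 : ℝ) 1, speed u γ t ≤ ∫⁻ t in Ioo (0 : ℝ) 1, ENNReal.ofReal (V * l) := by
        refine setLIntegral_mono' measurableSet_Ioo fun t ht => ENNReal.ofReal_le_ofReal ?_
        have ht' : t ∈ Icc (0 : ℝ) 1 := ⟨ht.1.le, ht.2.le⟩
        exact mul_le_mul (hV t ht') (hl t ht) (norm_nonneg _) ((abs_nonneg _).trans (hV t ht'))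
    _ = ENNReal.ofReal (V * l) := by simp

/-- The straight line from `x` to `y`. -/
lemma intrinsicDist_le_of_segment {U : Set E3} {u : E3 → ℝ} {V : ℝ} {x y : U}
    (hU : segment ℝ (x : E3) y ⊆ U) (hV : ∀ z ∈ segment ℝ (x : E3) y, |u z| ≤ V) :
    intrinsicDist U (conformalMetric u) x y ≤ ENNReal.ofReal (V * ‖(y : E3) - x‖) := by
  have hm : ∀ t ∈ Icc (0 : ℝ) 1, (x : E3) + t • ((y : E3) - x) ∈ segment ℝ (x : E3) y :=
    fun t ht => by rw [segment_eq_image']; exact ⟨t, ht, rfl⟩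
  refine intrinsicDist_le_of_norm_deriv_le (γ := fun t : ℝ => (x : E3) + t • ((y : E3) - x))
    (.of_contDiffOn (by fun_prop)) (fun t ht => hU (hm t ht)) (by simp) (by simp)
    (fun t ht => hV _ (hm t ht)) fun t _ => le_of_eq ?_
  congr 1
  have : HasDerivAt (fun t : ℝ => (x : E3) + t • ((y : E3) - x)) ((1 : ℝ) • ((y : E3) - x)) t :=
    ((hasDerivAt_id t).smul_const _).const_add _
  rw [this.deriv, one_smul]

/-! ### Bounding the Gromov–Hausdorff distance -/

/-- The metric defined by a finite extended metric. -/
@[reducible]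
noncomputable def metricSpaceOfENNReal {X : Type} (d : X → X → ℝ≥0∞) (hself : ∀ x, d x x = 0)
    (hcomm : ∀ x y, d x y = d y x) (htri : ∀ x y z, d x z ≤ d x y + d y z)
    (hpos : ∀ x y, d x y = 0 → x = y) (hfin : ∀ x y, d x y ≠ ⊤) : MetricSpace X where
  dist x y := (d x y).toReal
  dist_self x := by simp [hself]
  dist_comm x y := by rw [hcomm]
  dist_triangle x y z := by
    rw [← ENNReal.toReal_add (hfin x y) (hfin y z)]
    exact ENNReal.toReal_mono (ENNReal.add_ne_top.2 ⟨hfin x y, hfin y z⟩) (htri x y z)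
  eq_of_dist_eq_zero {x y} h :=
    hpos x y ((ENNReal.toReal_eq_zero_iff _).1 h |>.resolve_right (hfin x y))

lemma ghDist_le_of_approx {X Y : Type} [MetricSpace X] [MetricSpace Y] [Nonempty X]
    {dX : X → X → ℝ≥0∞} {dY : Y → Y → ℝ≥0∞} (hX : ∀ x x', edist x x' = dX x x')
    (hY : ∀ y y', edist y y' = dY y y') (Ψ : X → Y) {ε : ℝ} (hε : 0 < ε)
    (h₁ : ∀ x y, dX x y ≤ dY (Ψ x) (Ψ y) + ENNReal.ofReal ε)
    (h₂ : ∀ x y, dY (Ψ x) (Ψ y) ≤ dX x y + ENNReal.ofReal ε)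
    (h₃ : ∀ y, ∃ x, dY y (Ψ x) ≤ ENNReal.ofReal ε) :
    ghDist dX dY ≤ ENNReal.ofReal (2 * ε) := by
  simp only [← hX, ← hY, edist_dist] at h₁ h₂ h₃
  have hΦΨ : ∀ p q : X, |dist (id p) (id q) - dist (Ψ p) (Ψ q)| ≤ 2 * ε := by
    intro p q
    have e1 := h₁ p q
    have e2 := h₂ p q
    rw [← ENNReal.ofReal_add dist_nonneg hε.le,
      ENNReal.ofReal_le_ofReal_iff (add_nonneg dist_nonneg hε.le)] at e1 e2
    rw [abs_le, id, id]; constructor <;> linarith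
  -- The glued metric places `x` at distance exactly `ε` from `Ψ x`; it exists because the
  -- distortion of `Ψ` is at most `2 * ε`. A point of `Y` then needs `ε` to reach the range of `Ψ`
  -- and another `ε` to cross over.
  let mZ := Metric.glueMetricApprox (id : X → X) Ψ ε hε hΦΨ
  refine iInf_le_of_le (X ⊕ Y) (iInf_le_of_le mZ (iInf_le_of_le Sum.inl (iInf_le_of_le Sum.inr
    (iInf_le_of_le (fun x x' => ?_) (iInf_le_of_le (fun y y' => ?_) ?_)))))
  · rw [← hX, edist_dist, edist_dist]; rfl
  · rw [← hY, edist_dist, edist_dist]; rfl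
  · have hglue : ∀ x : X, dist (Sum.inl x : X ⊕ Y) (Sum.inr (Ψ x)) = ε := fun x =>
      Metric.glueDist_glued_points (id : X → X) Ψ ε x
    refine Metric.hausdorffEDist_le_of_mem_edist ?_ ?_
    · rintro _ ⟨x, rfl⟩
      refine ⟨Sum.inr (Ψ x), mem_range_self _, ?_⟩
      rw [edist_dist, hglue]
      exact ENNReal.ofReal_le_ofReal (by linarith)
    · rintro _ ⟨y, rfl⟩
      obtain ⟨x, hx⟩ := h₃ y
      refine ⟨Sum.inl x, mem_range_self _, ?_⟩
      have e1 : dist (Sum.inr y : X ⊕ Y) (Sum.inr (Ψ x)) ≤ ε :=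
        (ENNReal.ofReal_le_ofReal_iff hε.le).1 hx
      have e2 : dist (Sum.inr (Ψ x) : X ⊕ Y) (Sum.inl x) = ε := by rw [dist_comm, hglue]
      rw [edist_dist]
      exact ENNReal.ofReal_le_ofReal ((dist_triangle _ (Sum.inr (Ψ x)) _).trans (by linarith))

/-- The approximation is the inclusion. Finiteness of both distances is essential, since otherwise
no distance preserving map into a metric space exists. -/
lemma ghDist_le_of_subset {U W : Set E3} {u v : E3 → ℝ} (hUW : U ⊆ W) (hne : U.Nonempty)
    (hu : ∀ x ∈ W, 1 ≤ u x) (hv : ∀ x ∈ U, 1 ≤ v x)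
    (hufin : ∀ x y : W, intrinsicDist W (conformalMetric u) x y ≠ ⊤)
    (hvfin : ∀ x y : U, intrinsicDist U (conformalMetric v) x y ≠ ⊤) {ε : ℝ} (hε : 0 < ε)
    (h₁ : ∀ x y : U, intrinsicDist U (conformalMetric v) x y ≤
      intrinsicDist W (conformalMetric u) ⟨x, hUW x.2⟩ ⟨y, hUW y.2⟩ + ENNReal.ofReal ε)
    (h₂ : ∀ x y : U, intrinsicDist W (conformalMetric u) ⟨x, hUW x.2⟩ ⟨y, hUW y.2⟩ ≤
      intrinsicDist U (conformalMetric v) x y + ENNReal.ofReal ε)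
    (h₃ : ∀ y : W, ∃ x : U,
      intrinsicDist W (conformalMetric u) y ⟨x, hUW x.2⟩ ≤ ENNReal.ofReal ε) :
    ghDist (intrinsicDist U (conformalMetric v)) (intrinsicDist W (conformalMetric u)) ≤
      ENNReal.ofReal (2 * ε) := by
  have hpos : ∀ {U : Set E3} {u : E3 → ℝ} (_ : ∀ x ∈ U, 1 ≤ u x) (x y : U),
      intrinsicDist U (conformalMetric u) x y = 0 → x = y := by
    intro U u hu x y h0
    have := enorm_sub_le_intrinsicDist hu x y
    rw [h0, nonpos_iff_eq_zero, enorm_eq_zero, sub_eq_zero] at this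
    exact (Subtype.ext this).symm
  let mX := metricSpaceOfENNReal _ (intrinsicDist_self U v) (intrinsicDist_comm U v)
    (intrinsicDist_triangle U v) (hpos hv) hvfin
  let mY := metricSpaceOfENNReal _ (intrinsicDist_self W u) (intrinsicDist_comm W u)
    (intrinsicDist_triangle W u) (hpos hu) hufin
  exact @ghDist_le_of_approx U W mX mY hne.to_subtype _ _
    (fun x x' => (@edist_dist _ mX.toPseudoMetricSpace x x').trans
      (ENNReal.ofReal_toReal (hvfin x x')))
    (fun x x' => (@edist_dist _ mY.toPseudoMetricSpace x x').trans
      (ENNReal.ofReal_toReal (hufin x x'))) (fun x => ⟨x, hUW x.2⟩) ε hε h₁ h₂ h₃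

/-! ### Integrals of the Newton kernel -/

lemma volume_real_ball_le (x : E3) {r : ℝ} (hr : 0 ≤ r) :
    volume.real (Metric.ball x r) ≤ 5 * r ^ 3 := by
  rw [Measure.real, EuclideanSpace.volume_ball_fin_three, ENNReal.toReal_mul,
    ← ENNReal.ofReal_pow hr, ENNReal.toReal_ofReal (by positivity),
    ENNReal.toReal_ofReal (by positivity)]
  have := Real.pi_lt_d2
  have h3 : 0 ≤ r ^ 3 := by positivity
  nlinarith

lemma integrableOn_ball_inv_norm_sq (r : ℝ) :
    IntegrableOn (fun y : E3 => ‖y‖⁻¹ ^ 2) (Metric.ball 0 r) := by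
  rw [integrableOn_fun_norm_addHaar volume (f := fun t : ℝ => t⁻¹ ^ 2)]
  refine (integrableOn_const (C := (1 : ℝ)) (by simp)).congr_fun (fun t ht => ?_) measurableSet_Ioo
  have : t ≠ 0 := ht.1.ne'
  simp only [finrank_euclideanSpace, Fintype.card_fin, smul_eq_mul]
  field_simp

/-- In polar coordinates the Jacobian `t²` cancels the kernel, leaving `3 · vol(B₁) · r`, and the
unit ball has volume at most `5`. -/
lemma integral_ball_inv_norm_sq_le {r : ℝ} (hr : 0 ≤ r) :
    ∫ y in Metric.ball (0 : E3) r, ‖y‖⁻¹ ^ 2 ≤ 15 * r := by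
  have h1 : ∫ y in Metric.ball (0 : E3) r, ‖y‖⁻¹ ^ 2 =
      ∫ y : E3, (Iio r).indicator (fun t : ℝ => t⁻¹ ^ 2) ‖y‖ := by
    rw [← integral_indicator Metric.isOpen_ball.measurableSet]
    congr 1 with y
    simp [indicator]
  have h2 : ∫ t in Ioi (0 : ℝ), t ^ 2 * (Iio r).indicator (fun t : ℝ => t⁻¹ ^ 2) t = r := by
    have : ∀ t ∈ Ioi (0 : ℝ), t ^ 2 * (Iio r).indicator (fun t : ℝ => t⁻¹ ^ 2) t =
        (Iio r).indicator (fun _ => (1 : ℝ)) t := by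
      intro t ht
      have : t ≠ 0 := (mem_Ioi.1 ht).ne'
      by_cases h : t < r <;> simp [h]; field_simp
    rw [setIntegral_congr_fun measurableSet_Ioi this, setIntegral_indicator measurableSet_Iio,
      Ioi_inter_Iio]
    simp [hr]
  rw [h1, integral_fun_norm_addHaar]
  simp only [finrank_euclideanSpace, Fintype.card_fin, smul_eq_mul, nsmul_eq_mul,
    Nat.add_one_sub_one]
  rw [h2]
  have := volume_real_ball_le 0 zero_le_one
  push_cast
  nlinarith

/-- The half-open box `[-D, D)³`. -/
def halfOpenBox (D : ℝ) : Set E3 := {y | ∀ j, y j ∈ Ico (-D) D}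

lemma measurableSet_setOf_Ico (a b : Fin 3 → ℝ) :
    MeasurableSet {y : E3 | ∀ j, y j ∈ Ico (a j) (b j)} := by
  have : {y : E3 | ∀ j, y j ∈ Ico (a j) (b j)} = ⋂ j, (fun y : E3 => y j) ⁻¹' Ico (a j) (b j) := by
    ext; simp
  rw [this]
  exact MeasurableSet.iInter fun j => (by fun_prop : Measurable fun y : E3 => y j) measurableSet_Ico

lemma volume_setOf_Ico (a b : Fin 3 → ℝ) :
    volume {y : E3 | ∀ j, y j ∈ Ico (a j) (b j)} = ∏ j, ENNReal.ofReal (b j - a j) := by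
  rw [← Real.volume_pi_Ico, ← (PiLp.volume_preserving_ofLp (Fin 3)).measure_preimage
    (MeasurableSet.univ_pi fun _ => measurableSet_Ico).nullMeasurableSet]
  congr 1
  ext y
  simp

lemma volume_halfOpenBox (D : ℝ) : volume (halfOpenBox D) = ENNReal.ofReal (2 * D) ^ 3 := by
  rw [halfOpenBox, volume_setOf_Ico (fun _ => -D) fun _ => D]
  simp [two_mul]

lemma volume_real_halfOpenBox {D : ℝ} (hD : 0 < D) : volume.real (halfOpenBox D) = 8 * D ^ 3 := by
  rw [Measure.real, volume_halfOpenBox, ENNReal.toReal_pow, ENNReal.toReal_ofReal (by positivity)]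
  ring

lemma indicator_ball_inv_norm_sq (x : E3) (r : ℝ) :
    (Metric.ball x r).indicator (fun y : E3 => ‖x - y‖⁻¹ ^ 2) =
      fun y => (Metric.ball (0 : E3) r).indicator (fun y => ‖y‖⁻¹ ^ 2) (x - y) := by
  ext y
  simp [indicator, dist_eq_norm, norm_sub_rev y x]

lemma integrable_indicator_ball (x : E3) (r : ℝ) :
    Integrable ((Metric.ball x r).indicator (fun y : E3 => ‖x - y‖⁻¹ ^ 2)) := by
  rw [indicator_ball_inv_norm_sq]
  exact ((integrable_indicator_iff Metric.isOpen_ball.measurableSet).2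
    (integrableOn_ball_inv_norm_sq r)).comp_sub_left x

lemma integral_indicator_ball_le (x : E3) {r : ℝ} (hr : 0 ≤ r) :
    ∫ y, (Metric.ball x r).indicator (fun y : E3 => ‖x - y‖⁻¹ ^ 2) y ≤ 15 * r := by
  rw [indicator_ball_inv_norm_sq, integral_sub_left_eq_self
    ((Metric.ball (0 : E3) r).indicator (fun y => ‖y‖⁻¹ ^ 2)) volume x,
    integral_indicator Metric.isOpen_ball.measurableSet]
  exact integral_ball_inv_norm_sq_le hr

lemma measurable_inv_norm_sub (x : E3) : Measurable fun y : E3 => ‖x - y‖⁻¹ := by fun_prop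

lemma inv_norm_sq_le_indicator_add (x : E3) {D : ℝ} (hD : 0 < D) (y : E3) :
    ‖x - y‖⁻¹ ^ 2 ≤
      (Metric.ball x D).indicator (fun y : E3 => ‖x - y‖⁻¹ ^ 2) y + D⁻¹ ^ 2 := by
  by_cases h : y ∈ Metric.ball x D
  · simp [h, -inv_pow]; positivity
  · rw [indicator_of_notMem h, zero_add]
    rw [Metric.mem_ball', dist_eq_norm, not_lt] at h
    gcongr

lemma integrableOn_const_halfOpenBox (D c : ℝ) : IntegrableOn (fun _ => c) (halfOpenBox D) :=
  integrableOn_const (by rw [volume_halfOpenBox]; exact ENNReal.pow_ne_top ENNReal.ofReal_ne_top)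

lemma integrableOn_inv_norm_sq (x : E3) {D : ℝ} (hD : 0 < D) :
    IntegrableOn (fun y : E3 => ‖x - y‖⁻¹ ^ 2) (halfOpenBox D) := by
  refine Integrable.mono' ((integrable_indicator_ball x D).integrableOn.add
    (integrableOn_const_halfOpenBox D (D⁻¹ ^ 2)))
    ((measurable_inv_norm_sub x).pow_const 2).aestronglyMeasurable (ae_of_all _ fun y => ?_)
  rw [Real.norm_of_nonneg (by positivity)]
  exact inv_norm_sq_le_indicator_add x hD y

/-- The part of the kernel in the ball of radius `D` about `x` has mass at most `15 * D`; elsewhere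
the kernel is at most `D⁻²`, on a box of volume `8 * D³`. The bound does not depend on `x`. -/
lemma integral_inv_norm_sq_le (x : E3) {D : ℝ} (hD : 0 < D) :
    ∫ y in halfOpenBox D, ‖x - y‖⁻¹ ^ 2 ≤ 23 * D := by
  have hi := (integrable_indicator_ball x D).integrableOn (s := halfOpenBox D)
  have hc := integrableOn_const_halfOpenBox D (D⁻¹ ^ 2)
  calc ∫ y in halfOpenBox D, ‖x - y‖⁻¹ ^ 2
      ≤ ∫ y in halfOpenBox D,
        ((Metric.ball x D).indicator (fun y : E3 => ‖x - y‖⁻¹ ^ 2) y + D⁻¹ ^ 2) :=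
        integral_mono (integrableOn_inv_norm_sq x hD) (Integrable.add hi hc)
          (inv_norm_sq_le_indicator_add x hD)
    _ = (∫ y in halfOpenBox D, (Metric.ball x D).indicator (fun y : E3 => ‖x - y‖⁻¹ ^ 2) y) +
          8 * D := by
        rw [integral_add hi hc, setIntegral_const, volume_real_halfOpenBox hD, smul_eq_mul]
        congr 1
        field_simp
    _ ≤ 15 * D + 8 * D := by
        gcongr
        refine (setIntegral_le_integral (integrable_indicator_ball x D)
          (ae_of_all _ fun y => indicator_nonneg (fun _ _ => by positivity) y)).trans
          (integral_indicator_ball_le x hD.le)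
    _ = 23 * D := by ring

/-- An AM–GM estimate that reduces the integral of `1 / |x - y|` to that of its square. -/
lemma le_mul_sq_add_inv {D : ℝ} (hD : 0 < D) (t : ℝ) : t ≤ D * t ^ 2 + D⁻¹ := by
  have h := sq_nonneg (D * t - 1)
  have h2 := sq_nonneg (D * t)
  have : D * t ^ 2 + D⁻¹ - t = ((D * t) ^ 2 + 1 - D * t) / D := by field_simp
  have : 0 ≤ D * t ^ 2 + D⁻¹ - t := by rw [this]; apply div_nonneg _ hD.le; nlinarith
  linarith

lemma integrableOn_inv_norm (x : E3) {D : ℝ} (hD : 0 < D) :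
    IntegrableOn (fun y : E3 => ‖x - y‖⁻¹) (halfOpenBox D) := by
  refine Integrable.mono' (((integrableOn_inv_norm_sq x hD).const_mul D).add
    (integrableOn_const_halfOpenBox D D⁻¹))
    (measurable_inv_norm_sub x).aestronglyMeasurable (ae_of_all _ fun y => ?_)
  rw [Real.norm_of_nonneg (by positivity)]
  exact le_mul_sq_add_inv hD _

lemma integral_inv_norm_le (x : E3) {D : ℝ} (hD : 0 < D) :
    ∫ y in halfOpenBox D, ‖x - y‖⁻¹ ≤ 31 * D ^ 2 := by
  have hi := (integrableOn_inv_norm_sq x hD).const_mul D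
  have hc := integrableOn_const_halfOpenBox D D⁻¹
  calc ∫ y in halfOpenBox D, ‖x - y‖⁻¹
      ≤ ∫ y in halfOpenBox D, (D * ‖x - y‖⁻¹ ^ 2 + D⁻¹) :=
        integral_mono (integrableOn_inv_norm x hD) (hi.add hc) fun y => le_mul_sq_add_inv hD _
    _ = D * (∫ y in halfOpenBox D, ‖x - y‖⁻¹ ^ 2) + 8 * D ^ 2 := by
        rw [integral_add hi hc, setIntegral_const, volume_real_halfOpenBox hD, smul_eq_mul,
          integral_const_mul]
        congr 1
        field_simp
    _ ≤ D * (23 * D) + 8 * D ^ 2 := by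
        gcongr
        exact integral_inv_norm_sq_le x hD
    _ = 31 * D ^ 2 := by ring

/-- A difference of reciprocals `1/a - 1/b` is at most `|a - b| / (ab)`, and `1/(ab) ≤ 1/a² + 1/b²`.
At a pole the convention `0⁻¹ = 0` still gives the inequality. -/
lemma abs_inv_norm_sub_le (x x' y : E3) :
    |‖x - y‖⁻¹ - ‖x' - y‖⁻¹| ≤ ‖x - x'‖ * (‖x - y‖⁻¹ ^ 2 + ‖x' - y‖⁻¹ ^ 2) := by
  rcases eq_or_ne x y with rfl | h
  · rcases eq_or_ne x' x with rfl | h'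
    · simp
    · have : 0 < ‖x' - x‖ := norm_pos_iff.2 (sub_ne_zero.2 h')
      rw [norm_sub_rev x x']
      simp only [sub_self, norm_zero, inv_zero, zero_sub, abs_neg, abs_inv, abs_norm]
      apply le_of_eq; field_simp; ring
  · have hx : 0 < ‖x - y‖ := norm_pos_iff.2 (sub_ne_zero.2 h)
    rcases eq_or_ne x' y with rfl | h'
    · simp only [sub_self, norm_zero, inv_zero, sub_zero, abs_inv, abs_norm]
      apply le_of_eq; field_simp; ring
    · have hx' : 0 < ‖x' - y‖ := norm_pos_iff.2 (sub_ne_zero.2 h')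
      have h1 : |‖x - y‖⁻¹ - ‖x' - y‖⁻¹| = |‖x' - y‖ - ‖x - y‖| * (‖x - y‖⁻¹ * ‖x' - y‖⁻¹) := by
        rw [inv_sub_inv hx.ne' hx'.ne', abs_div, abs_of_pos (mul_pos hx hx')]
        field_simp
      rw [h1]
      refine mul_le_mul ?_ ?_ (by positivity) (norm_nonneg _)
      · refine (abs_norm_sub_norm_le _ _).trans (le_of_eq ?_)
        rw [norm_sub_rev x x']; congr 1; abel
      · nlinarith [sq_nonneg (‖x - y‖⁻¹ - ‖x' - y‖⁻¹), sq_nonneg (‖x - y‖⁻¹),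
          sq_nonneg (‖x' - y‖⁻¹)]

/-! ### Densities and their potentials -/

lemma isCompact_box (D : ℝ) : IsCompact (box D) := by
  have : box D = (EuclideanSpace.equiv (Fin 3) ℝ).toHomeomorph ⁻¹'
      (Set.univ.pi fun _ => Icc (-D) D) := by
    ext x
    exact ⟨fun h j _ => h j, fun h j => h j trivial⟩
  rw [this, Homeomorph.isCompact_preimage]
  exact isCompact_univ_pi fun _ => isCompact_Icc

lemma supNorm_nonneg (A : E3 → ℝ) : 0 ≤ supNorm A := Real.iSup_nonneg fun _ => abs_nonneg _

lemma supNormDeriv_nonneg (A : E3 → ℝ) : 0 ≤ supNormDeriv A :=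
  Real.iSup_nonneg fun _ => norm_nonneg _

lemma sampleConst_nonneg (D : ℝ) (A : E3 → ℝ) (α : (n : ℕ) → Index n → ℝ) :
    0 ≤ sampleConst D A α :=
  Real.iSup_nonneg fun _ => mul_nonneg (by positivity) (abs_nonneg _)

namespace IsDensity

variable {D : ℝ} {A : E3 → ℝ}

lemma hasCompactSupport (hA : IsDensity D A) : HasCompactSupport A :=
  HasCompactSupport.intro (isCompact_box D) fun x hx => by
    by_contra h; exact hx (hA.support_subset h)

/-- Compact support bounds the family, so that the real `⨆` is a genuine supremum and not the
default value `0` of an unbounded family. -/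
lemma abs_le_supNorm (hA : IsDensity D A) (x : E3) : |A x| ≤ supNorm A := by
  obtain ⟨C, hC⟩ := hA.smooth.continuous.bounded_above_of_compact_support hA.hasCompactSupport
  exact le_ciSup (f := fun x => |A x|) ⟨C, by rintro _ ⟨y, rfl⟩; exact hC y⟩ x

lemma abs_sub_le (hA : IsDensity D A) (x y : E3) :
    |A x - A y| ≤ supNormDeriv A * ‖x - y‖ := by
  obtain ⟨C, hC⟩ := (hA.smooth.continuous_fderiv (by simp)).bounded_above_of_compact_support
    (hA.hasCompactSupport.fderiv ℝ)
  refine Convex.norm_image_sub_le_of_norm_fderiv_le (𝕜 := ℝ) (s := univ)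
    (fun z _ => hA.smooth.differentiable (by simp) z) (fun z _ => ?_) convex_univ
    (mem_univ y) (mem_univ x)
  exact le_ciSup (f := fun x => ‖fderiv ℝ A x‖) ⟨C, by rintro _ ⟨y, rfl⟩; exact hC y⟩ z

/-- By continuity `A` vanishes on the faces of the closed box: a nonzero value there would persist
slightly outside. So integrals of `A` may be taken over the half-open box, which the cells partition
exactly. -/
lemma eq_zero_of_notMem (hA : IsDensity D A) {y : E3} (hy : y ∉ halfOpenBox D) : A y = 0 := by
  by_contra h
  have hyb := hA.support_subset h
  simp only [halfOpenBox, mem_ofPred_eq, not_forall] at hy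
  obtain ⟨j, hj⟩ := hy
  have hyj : D ≤ y j := by
    by_contra! hc; exact hj ⟨(hyb j).1, hc⟩
  have hcont : Continuous fun t : ℝ => A (y + t • EuclideanSpace.single j 1) :=
    hA.smooth.continuous.comp (by fun_prop)
  have h0 : ∀ᶠ t in 𝓝 (0 : ℝ), A (y + t • EuclideanSpace.single j 1) ≠ 0 :=
    hcont.continuousAt.eventually_ne (by simpa using h)
  obtain ⟨t, ht, ht0⟩ := ((h0.filter_mono nhdsWithin_le_nhds).and
    (self_mem_nhdsWithin (s := Ioi (0 : ℝ)))).exists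
  have h2 := (hA.support_subset ht j).2
  have ht0 : 0 < t := ht0
  simp only [PiLp.add_apply, PiLp.smul_apply, PiLp.single_apply] at h2
  simp only [if_true, smul_eq_mul, mul_one] at h2
  linarith

lemma limitFactor_eq (hA : IsDensity D A) (x : E3) :
    limitFactor A x = 1 + ∫ y in halfOpenBox D, A y * ‖x - y‖⁻¹ := by
  rw [limitFactor, setIntegral_eq_integral_of_forall_compl_eq_zero fun y hy => by
    rw [hA.eq_zero_of_notMem hy, zero_mul]]
  simp only [div_eq_mul_inv]

lemma integrableOn_mul_inv_norm (hA : IsDensity D A) (hD : 0 < D) (x : E3) :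
    IntegrableOn (fun y => A y * ‖x - y‖⁻¹) (halfOpenBox D) :=
  Integrable.bdd_mul (integrableOn_inv_norm x hD)
    hA.smooth.continuous.aestronglyMeasurable (ae_of_all _ hA.abs_le_supNorm)

lemma one_le_limitFactor (hA : IsDensity D A) (x : E3) : 1 ≤ limitFactor A x := by
  rw [hA.limitFactor_eq, le_add_iff_nonneg_right]
  exact integral_nonneg fun y => mul_nonneg (hA.nonneg y) (by positivity)

lemma limitFactor_le (hA : IsDensity D A) (hD : 0 < D) (x : E3) :
    limitFactor A x ≤ 1 + 31 * (supNorm A * D ^ 2) := by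
  rw [hA.limitFactor_eq]
  have : ∫ y in halfOpenBox D, A y * ‖x - y‖⁻¹ ≤ ∫ y in halfOpenBox D, supNorm A * ‖x - y‖⁻¹ :=
    integral_mono (hA.integrableOn_mul_inv_norm hD x) ((integrableOn_inv_norm x hD).const_mul _)
      fun y => by
        have := (le_abs_self _).trans (hA.abs_le_supNorm y)
        have h2 : 0 ≤ ‖x - y‖⁻¹ := by positivity
        exact mul_le_mul_of_nonneg_right this h2
  rw [integral_const_mul] at this
  have h2 := mul_le_mul_of_nonneg_left (integral_inv_norm_le x hD) (supNorm_nonneg A)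
  linarith

/-- Integrate the pointwise bound `abs_inv_norm_sub_le`; each of the two squared kernels contributes
`23 * D`. -/
lemma abs_limitFactor_sub_le (hA : IsDensity D A) (hD : 0 < D) (x x' : E3) :
    |limitFactor A x - limitFactor A x'| ≤ 46 * (supNorm A * D ^ 2) / D * ‖x - x'‖ := by
  have hi := (integrableOn_inv_norm_sq x hD)
  have hi' := (integrableOn_inv_norm_sq x' hD)
  rw [hA.limitFactor_eq, hA.limitFactor_eq, add_sub_add_left_eq_sub,
    ← integral_sub (hA.integrableOn_mul_inv_norm hD x) (hA.integrableOn_mul_inv_norm hD x')]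
  calc |∫ y in halfOpenBox D, (A y * ‖x - y‖⁻¹ - A y * ‖x' - y‖⁻¹)|
      ≤ ∫ y in halfOpenBox D,
          supNorm A * ‖x - x'‖ * (‖x - y‖⁻¹ ^ 2 + ‖x' - y‖⁻¹ ^ 2) := by
        rw [← Real.norm_eq_abs]
        refine norm_integral_le_of_norm_le ((Integrable.add hi hi').const_mul _)
          (ae_of_all _ fun y => ?_)
        rw [Real.norm_eq_abs, ← mul_sub, abs_mul, mul_assoc]
        exact mul_le_mul (hA.abs_le_supNorm y) (abs_inv_norm_sub_le x x' y) (abs_nonneg _)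
          (supNorm_nonneg A)
    _ ≤ supNorm A * ‖x - x'‖ * (23 * D + 23 * D) := by
        rw [integral_const_mul, integral_add hi hi']
        exact mul_le_mul_of_nonneg_left (add_le_add (integral_inv_norm_sq_le x hD)
          (integral_inv_norm_sq_le x' hD)) (mul_nonneg (supNorm_nonneg A) (norm_nonneg _))
    _ = 46 * (supNorm A * D ^ 2) / D * ‖x - x'‖ := by field_simp; ring

end IsDensity

/-! ### Riemann sums of potentials -/

/-- The half-open box of side length `D / n` with index `i`. -/
def cell (D : ℝ) (n : ℕ) (i : Index n) : Set E3 :=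
  {y | ∀ j, y j ∈ Ico ((((i j : ℕ) : ℝ) - n) * (D / n)) ((((i j : ℕ) : ℝ) - n + 1) * (D / n))}

lemma measurableSet_cell (D : ℝ) (n : ℕ) (i : Index n) : MeasurableSet (cell D n i) :=
  measurableSet_setOf_Ico _ _

lemma volume_real_cell {D : ℝ} (hD : 0 ≤ D) (n : ℕ) (i : Index n) :
    volume.real (cell D n i) = (D / n) ^ 3 := by
  rw [Measure.real, cell, volume_setOf_Ico (fun j => (((i j : ℕ) : ℝ) - n) * (D / n))
    fun j => (((i j : ℕ) : ℝ) - n + 1) * (D / n)]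
  simp only [← sub_mul, add_sub_cancel_left, one_mul]
  rw [Finset.prod_const, ENNReal.toReal_pow, ENNReal.toReal_ofReal (by positivity)]
  simp

lemma pairwise_disjoint_cell {D : ℝ} (hD : 0 < D) {n : ℕ} (hn : 1 ≤ n) :
    Pairwise (Function.onFun Disjoint (cell D n)) := by
  intro i k hik
  have hn' : (0 : ℝ) < n := by exact_mod_cast hn
  have hh : 0 < D / n := by positivity
  rw [Function.onFun, Set.disjoint_left]
  intro y hi hk
  refine hik (funext fun j => ?_)
  have h1 := (hi j).1.trans_lt (hk j).2
  have h2 := (hk j).1.trans_lt (hi j).2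
  rw [mul_lt_mul_iff_left₀ hh] at h1 h2
  have h3 : (i j : ℕ) < (k j : ℕ) + 1 := by
    exact_mod_cast (by linarith : ((i j : ℕ) : ℝ) < (k j : ℕ) + 1)
  have h4 : (k j : ℕ) < (i j : ℕ) + 1 := by
    exact_mod_cast (by linarith : ((k j : ℕ) : ℝ) < (i j : ℕ) + 1)
  exact Fin.ext (by omega)

lemma iUnion_cell {D : ℝ} (hD : 0 < D) {n : ℕ} (hn : 1 ≤ n) :
    ⋃ i, cell D n i = halfOpenBox D := by
  have hn' : (0 : ℝ) < n := by exact_mod_cast hn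
  have hh : 0 < D / n := by positivity
  have hnD : (n : ℝ) * (D / n) = D := by field_simp
  ext y
  simp only [mem_iUnion]
  constructor
  · rintro ⟨i, hi⟩ j
    have h1 : ((i j : ℕ) : ℝ) + 1 ≤ 2 * n := by exact_mod_cast (i j).2
    refine ⟨le_trans ?_ (hi j).1, (hi j).2.trans_le ?_⟩
    · have : (0 : ℝ) ≤ (i j : ℕ) := by positivity
      nlinarith
    · nlinarith
  · intro hy
    have hz : ∀ j, 0 ≤ y j / (D / n) + n := fun j => by
      have := (hy j).1
      rw [div_add' _ _ _ hh.ne']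
      exact div_nonneg (by linarith) hh.le
    refine ⟨fun j => ⟨⌊y j / (D / n) + n⌋₊, ?_⟩, fun j => ?_⟩
    · rw [Nat.floor_lt (hz j)]
      have := (hy j).2
      rw [div_add' _ _ _ hh.ne', div_lt_iff₀ hh]
      push_cast
      linarith
    · have h1 := Nat.floor_le (hz j)
      have h2 := Nat.lt_floor_add_one (y j / (D / n) + n)
      constructor
      · simp only
        rw [← le_div_iff₀ hh]; linarith
      · simp only
        rw [← div_lt_iff₀ hh]; linarith

lemma norm_sub_boxCenter_le {D : ℝ} (hD : 0 < D) {n : ℕ} {i : Index n} {y : E3}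
    (hy : y ∈ cell D n i) : ‖y - boxCenter D n i‖ ≤ D / n := by
  have hn : 0 ≤ D / n := by positivity
  have hj : ∀ j, (y j - boxCenter D n i j) ^ 2 ≤ ((D / n) / 2) ^ 2 := by
    intro j
    have hc : boxCenter D n i j = (((i j : ℕ) : ℝ) - (n : ℝ) + 1 / 2) * (D / n) := by
      simp only [boxCenter]; ring
    have := hy j
    rw [hc]
    apply sq_le_sq'
    · have := this.1; linarith
    · have := this.2; linarith
  rw [EuclideanSpace.norm_eq, Real.sqrt_le_left hn, Fin.sum_univ_three]
  simp only [PiLp.sub_apply, Real.norm_eq_abs, sq_abs]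
  nlinarith [hj 0, hj 1, hj 2, sq_nonneg (D / n)]

lemma sum_setIntegral_cell {D : ℝ} (hD : 0 < D) {n : ℕ} (hn : 1 ≤ n) {f : E3 → ℝ}
    (hf : IntegrableOn f (halfOpenBox D)) :
    ∑ i, ∫ y in cell D n i, f y = ∫ y in halfOpenBox D, f y := by
  rw [← iUnion_cell hD hn] at hf ⊢
  exact (integral_iUnion_fintype (measurableSet_cell D n) (pairwise_disjoint_cell hD hn)
    fun i => hf.mono_set (subset_iUnion _ i)).symm

lemma cell_subset {D : ℝ} (hD : 0 < D) {n : ℕ} (hn : 1 ≤ n) (i : Index n) :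
    cell D n i ⊆ halfOpenBox D := iUnion_cell hD hn ▸ subset_iUnion _ i

/-- A bound for the error in replacing the kernel at a point at distance at most `h` from `y` by
the kernel at `y`. -/
noncomputable def kernelError (h m : ℝ) (x y : E3) : ℝ :=
  3 * h * ‖x - y‖⁻¹ ^ 2 + (Metric.ball x (3 * h)).indicator (fun _ => m / h) y

/-- If `x` is at least `2h` from `p`, the distances to `p` and `y` are comparable and the difference
of reciprocals is of order `h / |x - y|²`. If not, the two reciprocals are bounded separately: the
first by `m / h`, as `x` is outside the hole, the second by the squared kernel, as `|x - y| < 3h`.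
-/
lemma abs_inv_norm_sub_le_kernelError {h m : ℝ} (hh : 0 < h) (hm : 0 < m) {x y p : E3}
    (hx : h / m ≤ ‖x - p‖) (hy : ‖y - p‖ ≤ h) :
    |‖x - p‖⁻¹ - ‖x - y‖⁻¹| ≤ kernelError h m x y := by
  have hx0 : 0 < ‖x - p‖ := lt_of_lt_of_le (by positivity) hx
  have t1 : ‖x - y‖ ≤ ‖x - p‖ + ‖y - p‖ := by
    rw [norm_sub_rev y p, show x - y = (x - p) + (p - y) by abel]; exact norm_add_le _ _
  have t2 : ‖x - p‖ ≤ ‖x - y‖ + ‖y - p‖ := by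
    rw [show x - p = (x - y) + (y - p) by abel]; exact norm_add_le _ _
  have hs : 0 ≤ ‖x - y‖⁻¹ := by positivity
  rcases lt_or_ge ‖x - p‖ (2 * h) with hlt | hge
  · have hb : y ∈ Metric.ball x (3 * h) := by
      rw [Metric.mem_ball', dist_eq_norm]; linarith
    rw [kernelError, indicator_of_mem hb]
    have h1 : ‖x - p‖⁻¹ ≤ m / h := by
      rw [← inv_div h m]; exact inv_anti₀ (by positivity) hx
    have h2 : ‖x - y‖⁻¹ ≤ 3 * h * ‖x - y‖⁻¹ ^ 2 := by
      rcases eq_or_lt_of_le (norm_nonneg (x - y)) with h0 | h0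
      · rw [← h0]; simp
      · rw [← div_le_iff₀ (by positivity)]
        rw [Metric.mem_ball', dist_eq_norm] at hb
        have : ‖x - y‖⁻¹ / ‖x - y‖⁻¹ ^ 2 = ‖x - y‖ := by field_simp
        rw [this]; exact hb.le
    have h3 : 0 ≤ ‖x - p‖⁻¹ := by positivity
    rw [abs_le]
    constructor <;> nlinarith
  · have hy0 : 0 < ‖x - y‖ := by linarith
    rw [kernelError]
    have h0 : 0 ≤ (Metric.ball x (3 * h)).indicator (fun _ => m / h) y :=
      indicator_nonneg (fun _ _ => by positivity) y
    refine le_trans ?_ (le_add_of_nonneg_right h0)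
    rw [inv_sub_inv hx0.ne' hy0.ne', abs_div, abs_of_pos (mul_pos hx0 hy0)]
    have h1 : |‖x - y‖ - ‖x - p‖| ≤ h := by rw [abs_le]; constructor <;> linarith
    rw [div_le_iff₀ (mul_pos hx0 hy0)]
    refine h1.trans ?_
    have : 3 * h * ‖x - y‖⁻¹ ^ 2 * (‖x - p‖ * ‖x - y‖) = h * (3 * ‖x - p‖ / ‖x - y‖) := by
      field_simp
    rw [this]
    refine le_mul_of_one_le_right hh.le ?_
    rw [one_le_div hy0]
    linarith

lemma integrableOn_kernelError {D : ℝ} (hD : 0 < D) (h m : ℝ) (x : E3) :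
    IntegrableOn (kernelError h m x) (halfOpenBox D) :=
  ((integrableOn_inv_norm_sq x hD).const_mul _).add
    (IntegrableOn.indicator (integrableOn_const_halfOpenBox D _) Metric.isOpen_ball.measurableSet)

/-- With `h = D / m` the near term has height `m² / D`, the inverse hole radius, on a ball of volume
at most `5 (3D / m)³`. Its mass is thus still `O(D² / m)`. The constant is `3 · 23 + 5 · 27`. -/
lemma integral_kernelError_le {D : ℝ} (hD : 0 < D) {m : ℝ} (hm : 0 < m) (x : E3) :
    ∫ y in halfOpenBox D, kernelError (D / m) m x y ≤ 204 * D ^ 2 / m := by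
  have h1 := (integrableOn_inv_norm_sq x hD).const_mul (3 * (D / m))
  have h2 : IntegrableOn ((Metric.ball x (3 * (D / m))).indicator fun _ => m / (D / m))
    (halfOpenBox D) := IntegrableOn.indicator (integrableOn_const_halfOpenBox D _)
      Metric.isOpen_ball.measurableSet
  simp only [kernelError]
  rw [integral_add h1 h2, integral_const_mul]
  have h3 : ∫ y in halfOpenBox D, (Metric.ball x (3 * (D / m))).indicator
      (fun _ => m / (D / m)) y ≤ 135 * D ^ 2 / m := by
    refine (setIntegral_le_integral ?_ (ae_of_all _ fun y =>
      indicator_nonneg (fun _ _ => by positivity) y)).trans ?_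
    · exact (integrable_indicator_iff Metric.isOpen_ball.measurableSet).2
        (integrableOn_const measure_ball_lt_top.ne)
    · rw [integral_indicator Metric.isOpen_ball.measurableSet, setIntegral_const, smul_eq_mul]
      refine (mul_le_mul_of_nonneg_right (volume_real_ball_le x (by positivity))
        (by positivity)).trans (le_of_eq ?_)
      field_simp; ring
  have h4 := mul_le_mul_of_nonneg_left (integral_inv_norm_sq_le x hD)
    (by positivity : 0 ≤ 3 * (D / m))
  have h5 : 3 * (D / m) * (23 * D) = 69 * D ^ 2 / m := by field_simp; ring
  have h6 : 204 * D ^ 2 / m = 69 * D ^ 2 / m + 135 * D ^ 2 / m := by ring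
  linarith

lemma IsAdmissible.abs_sub_le {D : ℝ} {A : E3 → ℝ} {α : (n : ℕ) → Index n → ℝ}
    (hα : IsAdmissible D A α) {n : ℕ} (hn : 1 ≤ n) (i : Index n) :
    |α n i - A (boxCenter D n i) * (D / n) ^ 3| ≤ sampleConst D A α / n ^ 4 := by
  have hn' : (0 : ℝ) < n := by exact_mod_cast hn
  rw [le_div_iff₀ (by positivity), mul_comm]
  exact le_ciSup hα.bddAbove (⟨n, i⟩ : Σ n : ℕ, Index n)

/-- The comparison is made cell by cell, with `α n i / h³` as a constant density on the cell. The
errors come from the sampling of `A`, from the variation of `A` and from moving the pole to the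
centre. The constant is `204 + 31`. -/
lemma abs_discreteFactor_sub_limitFactor_le {D : ℝ} (hD : 0 < D) {A : E3 → ℝ}
    (hA : IsDensity D A) {α : (n : ℕ) → Index n → ℝ} (hα : IsAdmissible D A α) {n : ℕ}
    (hn : 1 ≤ n) {x : E3} (hx : ∀ i, D / (n : ℝ) ^ 2 ≤ ‖x - boxCenter D n i‖) :
    |discreteFactor D α n x - limitFactor A x| ≤
      235 * (supNorm A * D ^ 2 + supNormDeriv A * D ^ 3 + sampleConst D A α / D) / n := by
  have hn1 : (1 : ℝ) ≤ n := by exact_mod_cast hn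
  have hn' : (0 : ℝ) < n := by linarith
  have hh : 0 < D / n := by positivity
  have hM := supNorm_nonneg A
  have hM1 := supNormDeriv_nonneg A
  have hC := sampleConst_nonneg D A α
  set M := supNorm A
  set M1 := supNormDeriv A
  set C := sampleConst D A α
  set h := D / n with hdef
  -- The sampling error `C / n⁴` divided by the cell volume `(D / n)³`.
  set K := C / (n * D ^ 3) with hK
  have hK0 : 0 ≤ K := by positivity
  have iT := integrableOn_inv_norm x hD
  have iG := integrableOn_kernelError hD h n x
  have iA := hA.integrableOn_mul_inv_norm hD x
  have hterm : ∀ i : Index n,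
      |α n i / ‖x - boxCenter D n i‖ - ∫ y in cell D n i, A y * ‖x - y‖⁻¹| ≤
        ∫ y in cell D n i, ((M + K) * kernelError h n x y + (M1 * h + K) * ‖x - y‖⁻¹) := by
    intro i
    set p := boxCenter D n i
    have hsub := cell_subset hD hn i
    have hfin : volume (cell D n i) ≠ ⊤ :=
      ((measure_mono hsub).trans_lt (by
        rw [volume_halfOpenBox]; exact ENNReal.pow_lt_top ENNReal.ofReal_lt_top)).ne
    have hcell : ∀ c : ℝ, ∫ _ in cell D n i, c = h ^ 3 * c := fun c => by
      rw [setIntegral_const, volume_real_cell hD.le, smul_eq_mul]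
    have e : α n i / ‖x - p‖ = ∫ _ in cell D n i, α n i / h ^ 3 * ‖x - p‖⁻¹ := by
      rw [hcell]; field_simp
    rw [e, ← integral_sub (integrableOn_const (C := α n i / h ^ 3 * ‖x - p‖⁻¹) hfin) (iA.mono_set hsub)]
    have iR : IntegrableOn (fun y => (M + K) * kernelError h n x y + (M1 * h + K) * ‖x - y‖⁻¹)
        (cell D n i) := 
      IntegrableOn.mono_set (Integrable.add (iG.const_mul _) (iT.const_mul _)) hsub
    rw [← Real.norm_eq_abs]
    refine norm_integral_le_of_norm_le iR ((ae_restrict_iff' (measurableSet_cell D n i)).2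
      (ae_of_all _ fun y hy => ?_))
    have hyp := norm_sub_boxCenter_le hD hy
    have hker : |‖x - p‖⁻¹ - ‖x - y‖⁻¹| ≤ kernelError h n x y :=
      abs_inv_norm_sub_le_kernelError hh hn' (by
        rw [hdef, div_div, ← sq]; exact hx i) hyp
    have hAy : |A p - A y| ≤ M1 * h := by
      refine (hA.abs_sub_le p y).trans (mul_le_mul_of_nonneg_left ?_ hM1)
      rwa [norm_sub_rev]
    have hαp : |α n i / h ^ 3 - A p| ≤ K := by
      have := hα.abs_sub_le hn i
      have h3 : 0 < h ^ 3 := by positivity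
      have e2 : α n i / h ^ 3 - A p = (α n i - A p * h ^ 3) / h ^ 3 := by field_simp
      rw [e2, abs_div, abs_of_pos h3, div_le_iff₀ h3]
      refine this.trans (le_of_eq ?_)
      rw [hK, hdef]; field_simp; rfl
    have hAp := hA.abs_le_supNorm p
    have ht : 0 ≤ ‖x - y‖⁻¹ := by positivity
    rw [Real.norm_eq_abs]
    -- Everything is expanded around `A p` and the kernel at `y`, so that the kernel at `p`, which
    -- is large near the hole, only occurs in differences controlled by `kernelError`.
    have e3 : α n i / h ^ 3 * ‖x - p‖⁻¹ - A y * ‖x - y‖⁻¹ =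
        (α n i / h ^ 3 - A p) * (‖x - p‖⁻¹ - ‖x - y‖⁻¹) + (α n i / h ^ 3 - A p) * ‖x - y‖⁻¹ +
        A p * (‖x - p‖⁻¹ - ‖x - y‖⁻¹) + (A p - A y) * ‖x - y‖⁻¹ := by ring
    rw [e3]
    refine (abs_add_le _ _).trans (add_le_add ((abs_add_le _ _).trans (add_le_add
      (abs_add_le _ _) le_rfl)) le_rfl) |>.trans ?_
    simp only [abs_mul, abs_of_nonneg ht]
    have f1 := mul_le_mul hαp hker (abs_nonneg _) hK0
    have f2 := mul_le_mul_of_nonneg_right hαp ht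
    have f3 := mul_le_mul hAp hker (abs_nonneg _) hM
    have f4 := mul_le_mul_of_nonneg_right hAy ht
    linarith
  have hsum : ∑ i, ∫ y in cell D n i, ((M + K) * kernelError h n x y + (M1 * h + K) * ‖x - y‖⁻¹)
      ≤ (M + K) * (204 * D ^ 2 / n) + (M1 * h + K) * (31 * D ^ 2) := by
    rw [sum_setIntegral_cell hD hn (f := fun y => (M + K) * kernelError h n x y +
        (M1 * h + K) * ‖x - y‖⁻¹) (Integrable.add (iG.const_mul _) (iT.const_mul _)),
      integral_add (iG.const_mul _) (iT.const_mul _), integral_const_mul, integral_const_mul]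
    refine add_le_add (mul_le_mul_of_nonneg_left (integral_kernelError_le hD hn' x)
      (by positivity)) (mul_le_mul_of_nonneg_left (integral_inv_norm_le x hD) (by positivity))
  rw [hA.limitFactor_eq, discreteFactor, add_sub_add_left_eq_sub, ← sum_setIntegral_cell hD hn iA,
    ← Finset.sum_sub_distrib]
  refine (Finset.abs_sum_le_sum_abs _ _).trans ((Finset.sum_le_sum fun i _ => hterm i).trans
    (hsum.trans ?_))
  have e : (M + K) * (204 * D ^ 2 / n) + (M1 * h + K) * (31 * D ^ 2) =
      (204 * (M * D ^ 2) + 204 * (C / D) / n + 31 * (M1 * D ^ 3) + 31 * (C / D)) / n := by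
    rw [hK, hdef]; field_simp; ring
  rw [e]
  have g1 : 0 ≤ M * D ^ 2 := by positivity
  have g2 : 0 ≤ M1 * D ^ 3 := by positivity
  have g3 : 0 ≤ C / D := by positivity
  have g4 : 204 * (C / D) / n ≤ 204 * (C / D) := div_le_self (by positivity) hn1
  gcongr
  linarith

lemma IsAdmissible.one_le_discreteFactor {D : ℝ} {A : E3 → ℝ} {α : (n : ℕ) → Index n → ℝ}
    (hα : IsAdmissible D A α) (n : ℕ) (x : E3) : 1 ≤ discreteFactor D α n x := by
  rw [discreteFactor, le_add_iff_nonneg_right]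
  exact Finset.sum_nonneg fun i _ => div_nonneg (hα.nonneg n i) (norm_nonneg _)

/-! ### Arcs on spheres -/

lemma norm_smul_add_smul_sq {e f : E3} (he : ‖e‖ = 1) (hf : ‖f‖ = 1) (hef : inner ℝ e f = 0)
    (a b : ℝ) : ‖a • e + b • f‖ ^ 2 = a ^ 2 + b ^ 2 := by
  rw [norm_add_sq_real, norm_smul, norm_smul, inner_smul_left, inner_smul_right, hef, he, hf]
  simp

lemma norm_inv_norm_smul {w : E3} (hw : w ≠ 0) : ‖‖w‖⁻¹ • w‖ = 1 := by
  rw [norm_smul, norm_inv, norm_norm, inv_mul_cancel₀ (norm_ne_zero_iff.2 hw)]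

lemma exists_unit_orthogonal {e : E3} (he : ‖e‖ = 1) : ∃ f : E3, ‖f‖ = 1 ∧ inner ℝ e f = 0 := by
  have : Fact (Module.finrank ℝ E3 = 2 + 1) := ⟨by simp⟩
  have h0 : e ≠ 0 := by rintro rfl; simp at he
  have hfr := Submodule.finrank_orthogonal_span_singleton (𝕜 := ℝ) (n := 2) h0
  have : Nontrivial (Submodule.span ℝ {e})ᗮ :=
    Module.nontrivial_of_finrank_pos (R := ℝ) (by rw [hfr]; norm_num)
  obtain ⟨f, hf⟩ := exists_ne (0 : (Submodule.span ℝ {e})ᗮ)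
  have hf0 : (f : E3) ≠ 0 := by simpa using hf
  refine ⟨‖(f : E3)‖⁻¹ • (f : E3), norm_inv_norm_smul hf0, ?_⟩
  rw [inner_smul_right, Submodule.mem_orthogonal_singleton_iff_inner_right.1 f.2, mul_zero]

lemma exists_eq_cos_smul_add_sin_smul {e b : E3} (he : ‖e‖ = 1) (hb : ‖b‖ = 1) :
    ∃ (f : E3) (θ : ℝ), ‖f‖ = 1 ∧ inner ℝ e f = 0 ∧ 0 ≤ θ ∧ θ ≤ Real.pi ∧
      b = Real.cos θ • e + Real.sin θ • f := by
  set c : ℝ := inner ℝ e b with hc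
  have hc1 : |c| ≤ 1 := by simpa [he, hb] using abs_real_inner_le_norm e b
  obtain ⟨hc2, hc3⟩ := abs_le.1 hc1
  set w := b - c • e with hw
  have hew : inner ℝ e w = 0 := by
    rw [hw, inner_sub_right, inner_smul_right, real_inner_self_eq_norm_sq, he, ← hc]; ring
  have hbw : b = c • e + w := by rw [hw]; abel
  have hw2 : ‖w‖ ^ 2 = 1 - c ^ 2 := by
    have : ‖b‖ ^ 2 = c ^ 2 + ‖w‖ ^ 2 := by
      conv_lhs => rw [hbw]
      rw [norm_add_sq_real, norm_smul, inner_smul_left, hew, he]; simp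
    rw [hb] at this; linarith
  have hsin : Real.sin (Real.arccos c) = ‖w‖ := by
    rw [Real.sin_arccos, ← hw2, Real.sqrt_sq (norm_nonneg _)]
  rcases eq_or_ne w 0 with h0 | h0
  · obtain ⟨f, hf, hef⟩ := exists_unit_orthogonal he
    refine ⟨f, Real.arccos c, hf, hef, Real.arccos_nonneg _, Real.arccos_le_pi _, ?_⟩
    rw [Real.cos_arccos hc2 hc3, hsin, h0, norm_zero, zero_smul]
    rw [h0] at hbw; exact hbw
  · refine ⟨‖w‖⁻¹ • w, Real.arccos c, norm_inv_norm_smul h0, ?_, Real.arccos_nonneg _,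
      Real.arccos_le_pi _, ?_⟩
    · rw [inner_smul_right, hew, mul_zero]
    · rw [Real.cos_arccos hc2 hc3, hsin, smul_smul, mul_inv_cancel₀ (norm_ne_zero_iff.2 h0),
        one_smul]
      exact hbw

/-- Two points of a sphere are joined by an arc of at most twice the length of the chord. -/
lemma intrinsicDist_le_of_sphere {U : Set E3} {u : E3 → ℝ} {V : ℝ} {p : E3} {r : ℝ} (hr : 0 < r)
    (hU : Metric.sphere p r ⊆ U) (hV : ∀ z ∈ Metric.sphere p r, |u z| ≤ V) {x y : U}
    (hx : (x : E3) ∈ Metric.sphere p r) (hy : (y : E3) ∈ Metric.sphere p r) :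
    intrinsicDist U (conformalMetric u) x y ≤ ENNReal.ofReal (V * (2 * ‖(y : E3) - x‖)) := by
  rw [mem_sphere_iff_norm] at hx hy
  have hunit : ∀ z : E3, ‖z - p‖ = r → ‖r⁻¹ • (z - p)‖ = 1 := fun z hz => by
    rw [norm_smul, hz, norm_inv, Real.norm_of_nonneg hr.le, inv_mul_cancel₀ hr.ne']
  have hback : ∀ z : E3, z = p + r • (r⁻¹ • (z - p)) := fun z => by
    rw [smul_inv_smul₀ hr.ne']; abel
  obtain ⟨f, θ, hf, hef, hθ0, hθπ, hb⟩ := exists_eq_cos_smul_add_sin_smul (hunit x hx) (hunit y hy)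
  have he := hunit x hx
  set e := r⁻¹ • ((x : E3) - p) with hedef
  have hxe : (x : E3) = p + r • e := hback x
  have hyb : (y : E3) = p + r • (Real.cos θ • e + Real.sin θ • f) := by rw [← hb]; exact hback y
  have hnorm : ∀ a b : ℝ, a ^ 2 + b ^ 2 = 1 → ‖a • e + b • f‖ = 1 := fun a b hab => by
    rw [← norm_smul_add_smul_sq he hf hef] at hab
    exact (pow_eq_one_iff_of_nonneg (norm_nonneg _) two_ne_zero).1 hab
  let γ : ℝ → E3 := fun t => p + r • (Real.cos (θ * t) • e + Real.sin (θ * t) • f)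
  have hγ : ∀ t, γ t ∈ Metric.sphere p r := fun t => by
    rw [mem_sphere_iff_norm]
    simp only [γ, add_sub_cancel_left]
    rw [norm_smul, hnorm _ _ (Real.cos_sq_add_sin_sq _), Real.norm_of_nonneg hr.le, mul_one]
  have hd : ∀ t, ‖deriv γ t‖ = r * θ := fun t => by
    have h1 : HasDerivAt (fun t : ℝ => θ * t) θ t := by simpa using (hasDerivAt_id t).const_mul θ
    have h2 : HasDerivAt γ (r • ((-Real.sin (θ * t) * θ) • e + (Real.cos (θ * t) * θ) • f)) t :=
      (((h1.cos.smul_const e).add (h1.sin.smul_const f)).const_smul r).const_add p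
    rw [h2.deriv]
    have : (-Real.sin (θ * t) * θ) • e + (Real.cos (θ * t) * θ) • f =
        θ • ((-Real.sin (θ * t)) • e + Real.cos (θ * t) • f) := by module
    rw [this, norm_smul, norm_smul, hnorm _ _ (by rw [neg_sq, Real.sin_sq_add_cos_sq]),
      Real.norm_of_nonneg hr.le, Real.norm_of_nonneg hθ0, mul_one]
  have hlen : r * θ ≤ 2 * ‖(y : E3) - x‖ := by
    have h1 : (y : E3) - x = r • ((Real.cos θ - 1) • e + Real.sin θ • f) := by
      rw [hyb, hxe]; module
    have h2 : ‖(y : E3) - x‖ ^ 2 = r ^ 2 * (2 * (1 - Real.cos θ)) := by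
      rw [h1, norm_smul, mul_pow, norm_smul_add_smul_sq he hf hef, Real.norm_of_nonneg hr.le]
      have := Real.sin_sq_add_cos_sq θ
      congr 1; linarith
    -- The squared chord is `2r²(1 - cos θ)`. The quadratic bound on the cosine for `|θ| ≤ π`, with
    -- `π² ≤ 16`, gives `θ² ≤ 8(1 - cos θ)`, hence arc² ≤ 4 chord².
    have h3 := Real.cos_le_one_sub_mul_cos_sq (x := θ) (by rwa [abs_of_nonneg hθ0])
    have hpi : Real.pi ^ 2 ≤ 16 := by nlinarith [Real.pi_lt_four, Real.pi_pos]
    have h4 : θ ^ 2 / 8 ≤ 2 / Real.pi ^ 2 * θ ^ 2 := by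
      rw [div_mul_eq_mul_div, div_le_div_iff₀ (by norm_num) (by positivity)]
      nlinarith [sq_nonneg θ]
    have h5 : θ ^ 2 ≤ 8 * (1 - Real.cos θ) := by linarith
    refine abs_le_of_sq_le_sq' ?_ (by positivity) |>.2
    rw [mul_pow, mul_pow, h2]
    nlinarith [sq_nonneg r, mul_le_mul_of_nonneg_left h5 (sq_nonneg r)]
  have hV0 : 0 ≤ V := (abs_nonneg _).trans (hV x (mem_sphere_iff_norm.2 hx))
  refine (intrinsicDist_le_of_norm_deriv_le (γ := γ) (l := r * θ)
    (.of_contDiffOn (by fun_prop)) (fun t _ => hU (hγ t)) ?_ ?_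
    (fun t _ => hV _ (hγ t)) fun t _ => (hd t).le).trans (ENNReal.ofReal_le_ofReal
      (mul_le_mul_of_nonneg_left hlen hV0))
  · simp only [γ, mul_zero, Real.cos_zero, Real.sin_zero, zero_smul, add_zero, one_smul]
    exact hxe.symm
  · simp only [γ, mul_one]
    exact hyb.symm

/-! ### Segments and balls -/

/-- The first and the last point of a segment on a sphere whose open ball it meets. -/
lemma exists_entry_exit {p z w : E3} {r : ℝ} (hz : z ∉ Metric.ball p r) (hw : w ∉ Metric.ball p r)
    (h : ∃ q ∈ segment ℝ z w, q ∈ Metric.ball p r) :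
    ∃ a ∈ Metric.sphere p r, ∃ b ∈ Metric.sphere p r,
      segment ℝ z a ⊆ segment ℝ z w ∧ segment ℝ b w ⊆ segment ℝ z w ∧
      Disjoint (segment ℝ z a) (Metric.ball p r) ∧ Disjoint (segment ℝ b w) (Metric.ball p r) ∧
      ‖a - z‖ + ‖b - a‖ + ‖w - b‖ = ‖w - z‖ := by
  obtain ⟨q, hq, hqb⟩ := h
  rw [segment_eq_image'] at hq
  obtain ⟨t, ht, rfl⟩ := hq
  let φ : ℝ → E3 := fun t => z + t • (w - z)
  have hφ : Continuous φ := by fun_prop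
  have hφ0 : φ 0 = z := by simp [φ]
  have hφ1 : φ 1 = w := by simp [φ]
  have hφt : φ t ∈ Metric.ball p r := hqb
  have hdist : Continuous fun s => dist (φ s) p := hφ.dist continuous_const
  rw [Metric.mem_ball, not_lt] at hz hw
  obtain ⟨s, hs, hsr⟩ := intermediate_value_Icc' ht.1 hdist.continuousOn
    (show r ∈ Icc (dist (φ t) p) (dist (φ 0) p) from
      ⟨(Metric.mem_ball.1 hφt).le, by rw [hφ0]; exact hz⟩)
  obtain ⟨s', hs', hsr'⟩ := intermediate_value_Icc ht.2 hdist.continuousOn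
    (show r ∈ Icc (dist (φ t) p) (dist (φ 1) p) from
      ⟨(Metric.mem_ball.1 hφt).le, by rw [hφ1]; exact hw⟩)
  have hseg : ∀ a b : ℝ, a ≤ b → segment ℝ (φ a) (φ b) = φ '' Icc a b := by
    intro a b hab
    have : φ = AffineMap.lineMap (k := ℝ) z w := by
      ext1 x; simp [φ, AffineMap.lineMap_apply, add_comm]
    rw [this, ← image_segment ℝ (AffineMap.lineMap z w), segment_eq_Icc hab]
  have hnorm : ∀ a b : ℝ, a ≤ b → ‖φ b - φ a‖ = (b - a) * ‖w - z‖ := by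
    intro a b hab
    have : φ b - φ a = (b - a) • (w - z) := by simp only [φ]; module
    rw [this, norm_smul, Real.norm_of_nonneg (sub_nonneg.2 hab)]
  have hzw : segment ℝ z w = φ '' Icc 0 1 := by rw [← hseg 0 1 zero_le_one, hφ0, hφ1]
  have hza : segment ℝ z (φ s) = φ '' Icc 0 s := by rw [← hseg 0 s hs.1, hφ0]
  have hbw : segment ℝ (φ s') w = φ '' Icc s' 1 := by rw [← hseg s' 1 hs'.2, hφ1]
  refine ⟨φ s, hsr, φ s', hsr', ?_, ?_, ?_, ?_, ?_⟩
  · rw [hza, hzw]; exact image_mono (Icc_subset_Icc le_rfl (hs.2.trans ht.2))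
  · rw [hbw, hzw]; exact image_mono (Icc_subset_Icc (ht.1.trans hs'.1) le_rfl)
  -- If a point before `φ s` were in the open ball, then by convexity so would `φ s`, which lies
  -- between it and `φ t`. So any crossing found by the intermediate value theorem serves as the
  -- entry point.
  · rw [Set.disjoint_left, hza]
    rintro _ ⟨x, hx, rfl⟩ hxb
    have : φ s ∈ segment ℝ (φ x) (φ t) := by
      rw [hseg x t (hx.2.trans hs.2)]; exact ⟨s, ⟨hx.2, hs.2⟩, rfl⟩
    exact ((convex_ball p r).segment_subset hxb hφt this).ne hsr
  · rw [Set.disjoint_left, hbw]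
    rintro _ ⟨x, hx, rfl⟩ hxb
    have : φ s' ∈ segment ℝ (φ t) (φ x) := by
      rw [hseg t x (hs'.1.trans hx.1)]; exact ⟨s', ⟨hs'.1, hx.1⟩, rfl⟩
    exact ((convex_ball p r).segment_subset hφt hxb this).ne hsr'
  · have h1 := hnorm 0 s hs.1
    have h2 := hnorm s s' (hs.2.trans hs'.1)
    have h3 := hnorm s' 1 hs'.2
    rw [hφ0] at h1
    rw [hφ1] at h3
    rw [h1, h2, h3]
    ring

/-! ### The perforated ball -/

lemma mem_perforatedBall {D R : ℝ} {n : ℕ} {x : E3} :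
    x ∈ perforatedBall D R n ↔ ‖x‖ < R ∧ ∀ i, D / (n : ℝ) ^ 2 ≤ ‖x - boxCenter D n i‖ := by
  simp [perforatedBall, dist_eq_norm]

lemma perforatedBall_subset (D R : ℝ) (n : ℕ) : perforatedBall D R n ⊆ Metric.ball 0 R :=
  sdiff_subset

lemma le_norm_boxCenter_sub {D : ℝ} (hD : 0 < D) {n : ℕ} {i k : Index n}
    (hik : i ≠ k) : D / n ≤ ‖boxCenter D n i - boxCenter D n k‖ := by
  obtain ⟨j, hj⟩ := Function.ne_iff.1 hik
  refine le_trans ?_ (PiLp.norm_apply_le _ j)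
  have hh : 0 ≤ D / n := by positivity
  have h1 : (boxCenter D n i - boxCenter D n k) j = (((i j : ℕ) : ℝ) - ((k j : ℕ) : ℝ)) * (D / n) := by
    simp only [boxCenter, PiLp.sub_apply]; ring
  rw [h1, norm_mul, Real.norm_of_nonneg hh]
  refine le_mul_of_one_le_left hh ?_
  have h2 : ((i j : ℕ) : ℤ) - ((k j : ℕ) : ℤ) ≠ 0 := by
    intro h; apply hj; apply Fin.ext; omega
  have := Int.one_le_abs h2
  rw [Real.norm_eq_abs]
  exact_mod_cast this

lemma norm_boxCenter_le {D : ℝ} (hD : 0 < D) {n : ℕ} (hn : 1 ≤ n) (i : Index n) :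
    ‖boxCenter D n i‖ ≤ √3 * (D - D / n / 2) := by
  have hn' : (1 : ℝ) ≤ n := by exact_mod_cast hn
  have hnD : (n : ℝ) * (D / n) = D := by field_simp
  have hh : 0 < D / n := by positivity
  have hb : 0 ≤ D - D / n / 2 := by nlinarith
  have hj : ∀ j, (boxCenter D n i j) ^ 2 ≤ (D - D / n / 2) ^ 2 := by
    intro j
    have hc : boxCenter D n i j = (((i j : ℕ) : ℝ) - (n : ℝ) + 1 / 2) * (D / n) := by
      simp only [boxCenter]; ring
    have h1 : ((i j : ℕ) : ℝ) + 1 ≤ 2 * n := by exact_mod_cast (i j).2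
    have h2 : (0 : ℝ) ≤ (i j : ℕ) := by positivity
    rw [hc]
    apply sq_le_sq' <;> nlinarith
  rw [EuclideanSpace.norm_eq, Real.sqrt_le_left (by positivity), Fin.sum_univ_three, mul_pow,
    Real.sq_sqrt (by norm_num)]
  simp only [Real.norm_eq_abs, sq_abs]
  linarith [hj 0, hj 1, hj 2]

section TwoLe

variable {D R : ℝ} {n : ℕ}

lemma radius_pos (hD : 0 < D) (hn : 2 ≤ n) : 0 < D / (n : ℝ) ^ 2 := by
  have : (2 : ℝ) ≤ n := by exact_mod_cast hn
  positivity

/-- The centres are at least `D / n` apart, so this makes the holes pairwise disjoint. It fails for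
`n = 1`, which therefore needs a separate treatment. -/
lemma two_mul_radius_le (hD : 0 < D) (hn : 2 ≤ n) : 2 * (D / (n : ℝ) ^ 2) ≤ D / n := by
  have : (2 : ℝ) ≤ n := by exact_mod_cast hn
  have hh : 0 < D / n := by positivity
  have : 2 * (D / (n : ℝ) ^ 2) = D / n * (2 / n) := by ring
  rw [this]
  exact mul_le_of_le_one_right hh.le (by rw [div_le_one (by positivity)]; assumption)

/-- A detour around one hole must avoid the others, by disjointness, and must stay in the ball: a
centre has norm at most `√3 (D - D/(2n))`, the radius is at most `D/(2n)`, and `√3 D < R`. -/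
lemma sphere_subset_perforatedBall (hD : 0 < D) (hR : √3 * D < R) (hn : 2 ≤ n) (i : Index n) :
    Metric.sphere (boxCenter D n i) (D / (n : ℝ) ^ 2) ⊆ perforatedBall D R n := by
  intro x hx
  rw [mem_sphere_iff_norm] at hx
  have h2 := two_mul_radius_le hD hn
  rw [mem_perforatedBall]
  constructor
  · have h1 := norm_boxCenter_le hD (by omega : 1 ≤ n) i
    have h3 : ‖x‖ ≤ ‖x - boxCenter D n i‖ + ‖boxCenter D n i‖ := by
      simpa using norm_add_le (x - boxCenter D n i) (boxCenter D n i)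
    have h4 : 1 ≤ √3 := Real.one_le_sqrt.2 (by norm_num)
    have h5 : 0 < D / n := by have := radius_pos hD hn; linarith
    nlinarith
  · intro k
    by_cases hik : i = k
    · rw [← hik, hx]
    · have h1 := le_norm_boxCenter_sub hD hik
      have h3 : ‖boxCenter D n i - boxCenter D n k‖ ≤
          ‖x - boxCenter D n i‖ + ‖x - boxCenter D n k‖ := by
        rw [norm_sub_rev x (boxCenter D n i)]
        simpa using norm_add_le (boxCenter D n i - x) (x - boxCenter D n k)
      linarith

lemma segment_subset_perforatedBall {z w : E3} (hz : z ∈ perforatedBall D R n)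
    (hw : w ∈ perforatedBall D R n)
    (h : ∀ i, Disjoint (segment ℝ z w) (Metric.ball (boxCenter D n i) (D / (n : ℝ) ^ 2))) :
    segment ℝ z w ⊆ perforatedBall D R n := fun q hq =>
  ⟨(convex_ball (0 : E3) R).segment_subset hz.1 hw.1 hq, fun hmem => by
    obtain ⟨i, hi⟩ := mem_iUnion.1 hmem
    exact Set.disjoint_left.1 (h i) hq hi⟩

lemma notMem_hole {z : E3} (hz : z ∈ perforatedBall D R n) (i : Index n) :
    z ∉ Metric.ball (boxCenter D n i) (D / (n : ℝ) ^ 2) := fun h =>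
  hz.2 (mem_iUnion.2 ⟨i, h⟩)

/-- Induction on a set containing all holes met by the segment. The chord through hole `i` is
replaced by an arc of at most twice its length; the two remaining segments miss hole `i` and meet no
new holes. The factor `2` does not accumulate, because the three parts add up to the original
segment. -/
lemma intrinsicDist_perforatedBall_le_of_finset (hD : 0 < D) (hR : √3 * D < R) (hn : 2 ≤ n)
    {v : E3 → ℝ} {V : ℝ} (hV : ∀ x ∈ perforatedBall D R n, |v x| ≤ V) (S : Finset (Index n)) :
    ∀ z w : perforatedBall D R n, (∀ i, ¬ Disjoint (segment ℝ (z : E3) w)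
      (Metric.ball (boxCenter D n i) (D / (n : ℝ) ^ 2)) → i ∈ S) →
      intrinsicDist (perforatedBall D R n) (conformalMetric v) z w ≤
        ENNReal.ofReal (V * (2 * ‖(w : E3) - z‖)) := by
  induction S using Finset.induction_on with
  | empty =>
    intro z w h
    have hs := segment_subset_perforatedBall z.2 w.2 fun i => by
      by_contra hc; exact Finset.notMem_empty _ (h i hc)
    have hV0 : 0 ≤ V := (abs_nonneg _).trans (hV z z.2)
    refine (intrinsicDist_le_of_segment hs fun q hq => hV q (hs hq)).trans
      (ENNReal.ofReal_le_ofReal (mul_le_mul_of_nonneg_left ?_ hV0))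
    linarith [norm_nonneg ((w : E3) - z)]
  | insert i S hi ih =>
    intro z w h
    have hV0 : 0 ≤ V := (abs_nonneg _).trans (hV z z.2)
    by_cases hd : Disjoint (segment ℝ (z : E3) w) (Metric.ball (boxCenter D n i) (D / (n : ℝ) ^ 2))
    · refine ih z w fun k hk => (Finset.mem_insert.1 (h k hk)).resolve_left ?_
      rintro rfl; exact hk hd
    · obtain ⟨a, ha, b, hb, hza, hbw, hda, hdb, hsum⟩ := exists_entry_exit (notMem_hole z.2 i)
        (notMem_hole w.2 i) (Set.not_disjoint_iff.1 hd)
      have hsph := sphere_subset_perforatedBall hD hR hn i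
      have h1 := ih z ⟨a, hsph ha⟩ fun k hk =>
        (Finset.mem_insert.1 (h k fun hc => hk (hc.mono_left hza))).resolve_left (by
          rintro rfl; exact hk hda)
      have h2 := ih ⟨b, hsph hb⟩ w fun k hk =>
        (Finset.mem_insert.1 (h k fun hc => hk (hc.mono_left hbw))).resolve_left (by
          rintro rfl; exact hk hdb)
      have h3 := intrinsicDist_le_of_sphere (x := ⟨a, hsph ha⟩) (y := ⟨b, hsph hb⟩)
        (radius_pos hD hn) hsph (fun q hq => hV q (hsph hq)) ha hb
      refine (intrinsicDist_triangle _ _ _ ⟨a, hsph ha⟩ _).trans ((add_le_add h1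
        ((intrinsicDist_triangle _ _ _ ⟨b, hsph hb⟩ _).trans (add_le_add h3 h2))).trans
        (le_of_eq ?_))
      rw [← ENNReal.ofReal_add (by positivity) (by positivity),
        ← ENNReal.ofReal_add (by positivity) (by positivity)]
      congr 1
      linear_combination 2 * V * hsum

/-- The intrinsic distance of the perforated ball is comparable to the Euclidean distance. -/
lemma intrinsicDist_perforatedBall_le (hD : 0 < D) (hR : √3 * D < R) (hn : 2 ≤ n)
    {v : E3 → ℝ} {V : ℝ} (hV : ∀ x ∈ perforatedBall D R n, |v x| ≤ V) (z w : perforatedBall D R n) :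
    intrinsicDist (perforatedBall D R n) (conformalMetric v) z w ≤
      ENNReal.ofReal (V * (2 * ‖(w : E3) - z‖)) :=
  intrinsicDist_perforatedBall_le_of_finset hD hR hn hV Finset.univ z w fun _ _ =>
    Finset.mem_univ _

/-- A point in a hole is pushed radially to its boundary sphere; from the centre any direction will
do. -/
lemma exists_mem_perforatedBall_norm_sub_le (hD : 0 < D) (hR : √3 * D < R) (hn : 2 ≤ n) {x : E3}
    (hx : x ∈ Metric.ball (0 : E3) R) :
    ∃ x' ∈ perforatedBall D R n, ‖x' - x‖ ≤ D / (n : ℝ) ^ 2 := by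
  have hr := radius_pos hD hn
  by_cases h : ∀ i, D / (n : ℝ) ^ 2 ≤ ‖x - boxCenter D n i‖
  · exact ⟨x, mem_perforatedBall.2 ⟨by simpa using hx, h⟩, by simpa using hr.le⟩
  push Not at h
  obtain ⟨i, hi⟩ := h
  set p := boxCenter D n i
  set r := D / (n : ℝ) ^ 2
  have key : ∃ e : E3, ‖e‖ = 1 ∧ x - p = ‖x - p‖ • e := by
    rcases eq_or_ne (x - p) 0 with h0 | h0
    · exact ⟨EuclideanSpace.single 0 1, by simp, by simp [h0]⟩
    · refine ⟨‖x - p‖⁻¹ • (x - p), norm_inv_norm_smul h0, ?_⟩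
      rw [smul_smul, mul_inv_cancel₀ (norm_ne_zero_iff.2 h0), one_smul]
  obtain ⟨e, he, hxe⟩ := key
  refine ⟨p + r • e, sphere_subset_perforatedBall hD hR hn i ?_, ?_⟩
  · rw [mem_sphere_iff_norm]
    rw [add_sub_cancel_left, norm_smul, he, mul_one, Real.norm_of_nonneg hr.le]
  · have : p + r • e - x = (r - ‖x - p‖) • e := by
      rw [sub_smul, ← hxe]; abel
    rw [this, norm_smul, he, mul_one, Real.norm_of_nonneg (by linarith)]
    linarith [norm_nonneg (x - p)]

/-- A short segment meets at most one hole. -/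
lemma intrinsicDist_perforatedBall_le_of_near (hD : 0 < D) (hR : √3 * D < R) (hn : 16 ≤ n)
    {v : E3 → ℝ} {V : ℝ} {z w : perforatedBall D R n} (hzw : ‖(w : E3) - z‖ ≤ D / n / 4)
    (hV : ∀ x ∈ perforatedBall D R n, ‖x - z‖ ≤ D / n → |v x| ≤ V) :
    intrinsicDist (perforatedBall D R n) (conformalMetric v) z w ≤
      ENNReal.ofReal (V * (‖(w : E3) - z‖ + 2 * (D / (n : ℝ) ^ 2))) := by
  have hn2 : 2 ≤ n := by omega
  have hr := radius_pos hD hn2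
  have hh : 0 < D / n := by linarith [two_mul_radius_le hD hn2]
  have hrh : 16 * (D / (n : ℝ) ^ 2) ≤ D / n := by
    have h16 : (16 : ℝ) ≤ n := by exact_mod_cast hn
    have : 16 * (D / (n : ℝ) ^ 2) = D / n * (16 / n) := by ring
    rw [this]
    exact mul_le_of_le_one_right hh.le (by rw [div_le_one (by positivity)]; assumption)
  have hV0 : 0 ≤ V := (abs_nonneg _).trans (hV z z.2 (by simpa using hh.le))
  have hseg : ∀ q ∈ segment ℝ (z : E3) w, ‖q - z‖ ≤ D / n / 4 := by
    intro q hq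
    exact (norm_sub_le_of_mem_segment hq).trans hzw
  have hstraight : ∀ a b : perforatedBall D R n, segment ℝ (a : E3) b ⊆ segment ℝ (z : E3) w →
      (∀ i, Disjoint (segment ℝ (a : E3) b) (Metric.ball (boxCenter D n i) (D / (n : ℝ) ^ 2))) →
      intrinsicDist (perforatedBall D R n) (conformalMetric v) a b ≤
        ENNReal.ofReal (V * ‖(b : E3) - a‖) := by
    intro a b hab hd
    have hs := segment_subset_perforatedBall a.2 b.2 hd
    exact intrinsicDist_le_of_segment hs fun q hq =>
      hV q (hs hq) ((hseg q (hab hq)).trans (by linarith))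
  by_cases hdis : ∀ i, Disjoint (segment ℝ (z : E3) w)
      (Metric.ball (boxCenter D n i) (D / (n : ℝ) ^ 2))
  · refine (hstraight z w subset_rfl hdis).trans
      (ENNReal.ofReal_le_ofReal (mul_le_mul_of_nonneg_left (by linarith) hV0))
  push Not at hdis
  obtain ⟨i, hi⟩ := hdis
  obtain ⟨q, hq, hqi⟩ := Set.not_disjoint_iff.1 hi
  obtain ⟨a, ha, b, hb, hza, hbw, hda, hdb, hsum⟩ := exists_entry_exit (notMem_hole z.2 i)
    (notMem_hole w.2 i) ⟨q, hq, hqi⟩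
  have hsph := sphere_subset_perforatedBall hD hR hn2 i
  rw [Metric.mem_ball, dist_eq_norm] at hqi
  have hpz : ‖boxCenter D n i - z‖ ≤ D / n / 4 + D / (n : ℝ) ^ 2 := by
    have h1 := hseg q hq
    have h2 : ‖boxCenter D n i - z‖ ≤ ‖q - boxCenter D n i‖ + ‖q - z‖ := by
      rw [norm_sub_rev q (boxCenter D n i)]
      simpa using norm_add_le (boxCenter D n i - q) (q - z)
    linarith
  -- With `h = D / n` and `r = D / n² ≤ h / 16`, the centre of any hole met is within `h/4 + r` of
  -- `z`. Two such centres would be less than `h/2 + 2r < h` apart.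
  have honly : ∀ k, k ≠ i → Disjoint (segment ℝ (z : E3) w)
      (Metric.ball (boxCenter D n k) (D / (n : ℝ) ^ 2)) := by
    intro k hk
    rw [Set.disjoint_left]
    intro q' hq' hqk
    rw [Metric.mem_ball, dist_eq_norm] at hqk
    have h1 := le_norm_boxCenter_sub hD hk
    have h2 : ‖boxCenter D n k - boxCenter D n i‖ ≤
        ‖q' - boxCenter D n k‖ + ‖q' - z‖ + ‖boxCenter D n i - z‖ := by
      rw [norm_sub_rev q' (boxCenter D n k), norm_sub_rev (boxCenter D n i)]
      simpa using norm_add₃_le (a := boxCenter D n k - q') (b := q' - z)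
        (c := z - boxCenter D n i)
    have := hseg q' hq'
    linarith
  have hdisj : ∀ a b : E3, segment ℝ a b ⊆ segment ℝ (z : E3) w →
      Disjoint (segment ℝ a b) (Metric.ball (boxCenter D n i) (D / (n : ℝ) ^ 2)) →
      ∀ k, Disjoint (segment ℝ a b) (Metric.ball (boxCenter D n k) (D / (n : ℝ) ^ 2)) := by
    intro a b h1 h2 k
    rcases eq_or_ne k i with rfl | hk
    · exact h2
    · exact (honly k hk).mono_left h1
  have h1 := hstraight z ⟨a, hsph ha⟩ hza (hdisj _ _ hza hda)
  have h2 := hstraight ⟨b, hsph hb⟩ w hbw (hdisj _ _ hbw hdb)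
  have h3 := intrinsicDist_le_of_sphere (u := v) (V := V) (x := ⟨a, hsph ha⟩) (y := ⟨b, hsph hb⟩)
    hr hsph (fun q hq => hV q (hsph hq) (by
      rw [mem_sphere_iff_norm] at hq
      have : ‖q - z‖ ≤ ‖q - boxCenter D n i‖ + ‖boxCenter D n i - z‖ := by
        simpa using norm_add_le (q - boxCenter D n i) (boxCenter D n i - z)
      linarith)) ha hb
  have hab : ‖b - a‖ ≤ 2 * (D / (n : ℝ) ^ 2) := by
    rw [mem_sphere_iff_norm] at ha hb
    have := norm_sub_le (b - boxCenter D n i) (a - boxCenter D n i)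
    rw [sub_sub_sub_cancel_right] at this
    linarith
  refine (intrinsicDist_triangle _ _ _ ⟨a, hsph ha⟩ _).trans ((add_le_add h1
    ((intrinsicDist_triangle _ _ _ ⟨b, hsph hb⟩ _).trans (add_le_add h3 h2))).trans ?_)
  rw [← ENNReal.ofReal_add (by positivity) (by positivity),
    ← ENNReal.ofReal_add (by positivity) (by positivity)]
  refine ENNReal.ofReal_le_ofReal ?_
  -- Going around instead of through costs at most one extra chord, of length at most the hole's
  -- diameter. Hence an additive error and no factor `2`.
  have : V * ‖a - z‖ + (V * (2 * ‖b - a‖) + V * ‖(w : E3) - b‖) =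
      V * (‖(w : E3) - z‖ + ‖b - a‖) := by linear_combination V * hsum
  rw [this]
  exact mul_le_mul_of_nonneg_left (by linarith) hV0

end TwoLe

/-! ### Lengths of pieces of a path -/

/-- The real-valued speed of a path, an integrable function for paths of finite length. -/
noncomputable def realSpeed (u : E3 → ℝ) (γ : ℝ → E3) (t : ℝ) : ℝ := |u (γ t)| * ‖deriv γ t‖

lemma realSpeed_nonneg (u : E3 → ℝ) (γ : ℝ → E3) (t : ℝ) : 0 ≤ realSpeed u γ t :=
  mul_nonneg (abs_nonneg _) (norm_nonneg _)

lemma intervalIntegrable_realSpeed {u : E3 → ℝ} (hu : Continuous u) {γ : ℝ → E3}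
    (h : IsPiecewiseSmooth γ) (hfin : pathLength (conformalMetric u) γ ≠ ⊤) {s t : ℝ} (hs : 0 ≤ s)
    (hst : s ≤ t) (ht : t ≤ 1) :
    IntervalIntegrable (realSpeed u γ) volume s t := by
  rw [pathLength_conformalMetric] at hfin
  have h01 : IntegrableOn (realSpeed u γ) (Ioo 0 1) := by
    refine ⟨?_, ?_⟩
    · have h1 : ContinuousOn (fun t => |u (γ t)|) (Ioo 0 1) :=
        ((hu.comp_continuousOn h.continuousOn).abs).mono Ioo_subset_Icc_self
      exact (h1.aestronglyMeasurable measurableSet_Ioo).mul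
        (stronglyMeasurable_deriv γ).norm.aestronglyMeasurable
    · refine lt_of_le_of_lt (le_of_eq ?_) (lt_top_iff_ne_top.2 hfin)
      refine lintegral_congr fun t => ?_
      rw [← ofReal_norm, Real.norm_of_nonneg (realSpeed_nonneg u γ t)]
      rfl
  rw [intervalIntegrable_iff_integrableOn_Ioo_of_le hst]
  exact h01.mono_set (Ioo_subset_Ioo hs ht)

lemma ofReal_integral_realSpeed {u : E3 → ℝ} (hu : Continuous u) {γ : ℝ → E3}
    (h : IsPiecewiseSmooth γ) (hfin : pathLength (conformalMetric u) γ ≠ ⊤) :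
    ENNReal.ofReal (∫ t in (0 : ℝ)..1, realSpeed u γ t) = pathLength (conformalMetric u) γ := by
  have hi := intervalIntegrable_realSpeed hu h hfin le_rfl zero_le_one le_rfl
  rw [intervalIntegrable_iff_integrableOn_Ioo_of_le zero_le_one] at hi
  rw [intervalIntegral.integral_of_le zero_le_one, integral_Ioc_eq_integral_Ioo,
    ofReal_integral_eq_lintegral_ofReal hi (ae_of_all _ (realSpeed_nonneg u γ)),
    pathLength_conformalMetric]
  rfl

lemma intervalIntegrable_norm_deriv {u : E3 → ℝ} (hu : Continuous u) {γ : ℝ → E3}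
    (h : IsPiecewiseSmooth γ) (hfin : pathLength (conformalMetric u) γ ≠ ⊤)
    (hu1 : ∀ x, 1 ≤ u x) {s t : ℝ} (hs : 0 ≤ s) (hst : s ≤ t) (ht : t ≤ 1) :
    IntervalIntegrable (fun t => ‖deriv γ t‖) volume s t := by
  refine (intervalIntegrable_realSpeed hu h hfin hs hst ht).mono_fun
    (stronglyMeasurable_deriv γ).norm.aestronglyMeasurable (ae_of_all _ fun x => ?_)
  beta_reduce
  rw [norm_norm, Real.norm_of_nonneg (realSpeed_nonneg u γ x)]
  exact le_mul_of_one_le_left (norm_nonneg _) ((hu1 _).trans (le_abs_self _))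

lemma norm_sub_le_integral_norm_deriv {γ : ℝ → E3} (h : IsPiecewiseSmooth γ) {s t : ℝ}
    (hs : 0 ≤ s) (hst : s ≤ t) (ht : t ≤ 1)
    (hi : IntervalIntegrable (fun t => ‖deriv γ t‖) volume s t) :
    ‖γ t - γ s‖ ≤ ∫ x in s..t, ‖deriv γ x‖ := by
  have h1 := h.enorm_sub_le hs hst ht
  rw [intervalIntegrable_iff_integrableOn_Ioo_of_le hst] at hi
  have h0 : 0 ≤ ∫ x in s..t, ‖deriv γ x‖ :=
    intervalIntegral.integral_nonneg hst fun _ _ => norm_nonneg _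
  rw [← ofReal_norm] at h1
  rw [← ENNReal.ofReal_le_ofReal_iff h0]
  refine h1.trans (le_of_eq ?_)
  rw [intervalIntegral.integral_of_le hst, integral_Ioc_eq_integral_Ioo,
    ofReal_integral_eq_lintegral_ofReal hi (ae_of_all _ fun _ => norm_nonneg _)]
  simp only [ofReal_norm]

lemma continuous_of_abs_sub_le {u : E3 → ℝ} {K : ℝ} (h : ∀ x y, |u x - u y| ≤ K * ‖x - y‖) :
    Continuous u := by
  have hK : LipschitzWith K.toNNReal u := LipschitzWith.of_dist_le_mul fun x y => by
    rw [Real.dist_eq, dist_eq_norm]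
    exact (h x y).trans (mul_le_mul_of_nonneg_right (Real.le_coe_toNNReal K) (norm_nonneg _))
  exact hK.continuous

/-- If `u` varies slowly, then the Euclidean distance of the endpoints of a short piece of a path,
times the value of `u` at the start, is almost bounded by the length of the piece. -/
lemma mul_norm_sub_le_integral {u : E3 → ℝ} (hu1 : ∀ x, 1 ≤ u x) {K : ℝ} (hK : 0 ≤ K)
    (hLip : ∀ x y, |u x - u y| ≤ K * ‖x - y‖) {γ : ℝ → E3}
    (h : IsPiecewiseSmooth γ) (hfin : pathLength (conformalMetric u) γ ≠ ⊤) {s t : ℝ} (hs : 0 ≤ s)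
    (hst : s ≤ t) (ht : t ≤ 1) {l : ℝ} (hl : ∫ x in s..t, realSpeed u γ x ≤ l) :
    ‖γ t - γ s‖ ≤ ∫ x in s..t, realSpeed u γ x ∧
      u (γ s) * ‖γ t - γ s‖ ≤ (1 + K * l) * ∫ x in s..t, realSpeed u γ x := by
  have hu := continuous_of_abs_sub_le hLip
  have hle : ∀ x, ‖deriv γ x‖ ≤ realSpeed u γ x := fun x =>
    le_mul_of_one_le_left (norm_nonneg _) ((hu1 _).trans (le_abs_self _))
  have key : ∀ τ ∈ Icc s t, ‖γ τ - γ s‖ ≤ ∫ x in s..τ, ‖deriv γ x‖ ∧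
      ∫ x in s..τ, ‖deriv γ x‖ ≤ ∫ x in s..τ, realSpeed u γ x := fun τ hτ => by
    have hi := intervalIntegrable_norm_deriv hu h hfin hu1 hs hτ.1 (hτ.2.trans ht)
    exact ⟨norm_sub_le_integral_norm_deriv h hs hτ.1 (hτ.2.trans ht) hi,
      intervalIntegral.integral_mono_on hτ.1 hi
        (intervalIntegrable_realSpeed hu h hfin hs hτ.1 (hτ.2.trans ht)) fun x _ => hle x⟩
  have hi := intervalIntegrable_norm_deriv hu h hfin hu1 hs hst ht
  have hi' := intervalIntegrable_realSpeed hu h hfin hs hst ht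
  obtain ⟨k1, k2⟩ := key t ⟨hst, le_rfl⟩
  refine ⟨k1.trans k2, ?_⟩
  -- On the piece the path stays within `l` of its start, so `u` drops by at most `K * l`.
  -- Integrating over the piece compares the chord, weighted by the initial value of `u`, with the
  -- conformal length.
  have hpt : ∀ τ ∈ Icc s t, u (γ s) * ‖deriv γ τ‖ ≤ realSpeed u γ τ + K * l * ‖deriv γ τ‖ := by
    intro τ hτ
    obtain ⟨k3, k4⟩ := key τ hτ
    have h5 : ∫ x in s..τ, realSpeed u γ x ≤ ∫ x in s..t, realSpeed u γ x :=
      intervalIntegral.integral_mono_interval le_rfl hτ.1 hτ.2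
        (ae_of_all _ fun x => realSpeed_nonneg u γ x) hi'
    have h6 : ‖γ s - γ τ‖ ≤ l := by rw [norm_sub_rev]; linarith
    have h7 := (le_abs_self _).trans (hLip (γ s) (γ τ))
    have h8 := mul_le_mul_of_nonneg_left h6 hK
    have h9 : u (γ s) ≤ |u (γ τ)| + K * l := by linarith [le_abs_self (u (γ τ))]
    calc u (γ s) * ‖deriv γ τ‖ ≤ (|u (γ τ)| + K * l) * ‖deriv γ τ‖ :=
          mul_le_mul_of_nonneg_right h9 (norm_nonneg _)
      _ = realSpeed u γ τ + K * l * ‖deriv γ τ‖ := by rw [realSpeed]; ring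
  have hint := intervalIntegral.integral_mono_on hst (hi.const_mul (u (γ s)))
    (hi'.add (hi.const_mul (K * l))) hpt
  rw [intervalIntegral.integral_add hi' (hi.const_mul _), intervalIntegral.integral_const_mul,
    intervalIntegral.integral_const_mul] at hint
  have hu0 : 0 ≤ u (γ s) := zero_le_one.trans (hu1 _)
  have hF0 : 0 ≤ ∫ x in s..t, realSpeed u γ x :=
    intervalIntegral.integral_nonneg hst fun x _ => realSpeed_nonneg u γ x
  have hKl : 0 ≤ K * l := mul_nonneg hK (hF0.trans hl)
  have g1 := mul_le_mul_of_nonneg_left k1 hu0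
  have g2 := mul_le_mul_of_nonneg_left k2 hKl
  linarith

/-! ### Comparison of the intrinsic distances -/

section Comparison

variable {D R : ℝ} {n : ℕ} {u v : E3 → ℝ} {Λ : ℝ}

lemma norm_sub_le_of_mem_ball {x y : E3} (hx : x ∈ Metric.ball (0 : E3) R)
    (hy : y ∈ Metric.ball (0 : E3) R) : ‖y - x‖ ≤ 2 * R := by
  rw [mem_ball_zero_iff] at hx hy
  linarith [norm_sub_le y x]

lemma intrinsicDist_ball_le (huΛ : ∀ x, |u x| ≤ Λ) (x y : Metric.ball (0 : E3) R) :
    intrinsicDist (Metric.ball 0 R) (conformalMetric u) x y ≤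
      ENNReal.ofReal (Λ * ‖(y : E3) - x‖) :=
  intrinsicDist_le_of_segment ((convex_ball _ _).segment_subset x.2 y.2) fun z _ => huΛ z

/-- A path in the perforated ball is also a path in the ball, and there `u ≤ v + Λ/n ≤ (1 + Λ/n) v`
because `v ≥ 1`. -/
lemma intrinsicDist_ball_le_mul (hn : 1 ≤ n) (hΛ : 1 ≤ Λ) (hv1 : ∀ x ∈ perforatedBall D R n, 1 ≤ v x)
    (hu0 : ∀ x, 0 ≤ u x)
    (huv : ∀ x ∈ perforatedBall D R n, |v x - u x| ≤ Λ / n) (x y : perforatedBall D R n) :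
    intrinsicDist (Metric.ball 0 R) (conformalMetric u)
        ⟨x, perforatedBall_subset D R n x.2⟩ ⟨y, perforatedBall_subset D R n y.2⟩ ≤
      ENNReal.ofReal (1 + Λ / n) * intrinsicDist (perforatedBall D R n) (conformalMetric v) x y := by
  have hn' : (1 : ℝ) ≤ n := by exact_mod_cast hn
  have hc : 0 < 1 + Λ / n := by positivity
  have hc0 : ENNReal.ofReal (1 + Λ / n) ≠ 0 := by simpa using hc
  rw [mul_comm, ← ENNReal.div_le_iff_le_mul (Or.inl hc0) (Or.inl ENNReal.ofReal_ne_top)]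
  refine le_intrinsicDist fun γ h1 h2 h3 h4 => ?_
  rw [ENNReal.div_le_iff_le_mul (Or.inl hc0) (Or.inl ENNReal.ofReal_ne_top), mul_comm]
  refine (intrinsicDist_le_pathLength h1 (fun t ht => perforatedBall_subset D R n (h2 ht))
    h3 h4).trans ?_
  rw [pathLength_conformalMetric, pathLength_conformalMetric,
    ← lintegral_const_mul' _ _ ENNReal.ofReal_ne_top]
  refine setLIntegral_mono' measurableSet_Ioo fun t ht => ?_
  rw [speed, speed, ← ENNReal.ofReal_mul hc.le]
  refine ENNReal.ofReal_le_ofReal ?_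
  have hm := h2 ⟨ht.1.le, ht.2.le⟩
  have e1 := (abs_le.1 (huv _ hm)).1
  have e2 := hv1 _ hm
  rw [abs_of_nonneg (hu0 _), abs_of_nonneg (zero_le_one.trans e2), ← mul_assoc]
  refine mul_le_mul_of_nonneg_right ?_ (norm_nonneg _)
  have e3 : Λ / n ≤ Λ / n * v (γ t) := le_mul_of_one_le_right (by positivity) e2
  linarith

/-- The endpoints `z`, `w` are points of the perforated ball next to those of the piece. To first
order the conformal factor is the constant `u (γ s)`; its variation only multiplies the length by `1
+ O(Λ/n)`, while moving the endpoints and avoiding one hole adds a multiple of `Λ D / n²`. -/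
lemma intrinsicDist_perforatedBall_le_of_piece (hD : 0 < D) (hR : √3 * D < R) (hn : 16 ≤ n)
    (hΛ : 1 ≤ Λ) (hu1 : ∀ x, 1 ≤ u x) (huΛ : ∀ x, u x ≤ Λ)
    (hLip : ∀ x y, |u x - u y| ≤ Λ / D * ‖x - y‖)
    (hv1 : ∀ x ∈ perforatedBall D R n, 1 ≤ v x)
    (huv : ∀ x ∈ perforatedBall D R n, |v x - u x| ≤ Λ / n)
    {γ : ℝ → E3} (h : IsPiecewiseSmooth γ) (hfin : pathLength (conformalMetric u) γ ≠ ⊤) {s t : ℝ}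
    (hs : 0 ≤ s) (hst : s ≤ t) (ht : t ≤ 1) (hl : ∫ x in s..t, realSpeed u γ x ≤ D / n / 8)
    {z w : perforatedBall D R n} (hz : ‖(z : E3) - γ s‖ ≤ D / (n : ℝ) ^ 2)
    (hw : ‖(w : E3) - γ t‖ ≤ D / (n : ℝ) ^ 2) :
    intrinsicDist (perforatedBall D R n) (conformalMetric v) z w ≤
      ENNReal.ofReal ((1 + 4 * Λ / n) * (∫ x in s..t, realSpeed u γ x) +
        16 * Λ * (D / (n : ℝ) ^ 2)) := by
  have hn16 : (16 : ℝ) ≤ n := by exact_mod_cast hn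
  have hr : 0 < D / (n : ℝ) ^ 2 := radius_pos hD (by omega)
  have hh : 0 < D / n := by positivity
  have hrh : 16 * (D / (n : ℝ) ^ 2) ≤ D / n := by
    have : 16 * (D / (n : ℝ) ^ 2) = D / n * (16 / n) := by ring
    rw [this]
    exact mul_le_of_le_one_right hh.le (by rw [div_le_one (by positivity)]; assumption)
  have hK : 0 ≤ Λ / D := by positivity
  obtain ⟨k1, k2⟩ := mul_norm_sub_le_integral hu1 hK hLip h hfin hs hst ht hl
  set F := ∫ x in s..t, realSpeed u γ x with hF
  have hKh : Λ / D * (D / n) = Λ / n := by field_simp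
  have hwz : ‖(w : E3) - z‖ ≤ ‖γ t - γ s‖ + 2 * (D / (n : ℝ) ^ 2) := by
    have e : (w : E3) - z = (w - γ t) + (γ t - γ s) + (γ s - z) := by abel
    have := norm_add₃_le (a := (w : E3) - γ t) (b := γ t - γ s) (c := γ s - z)
    rw [← e, norm_sub_rev (γ s)] at this
    linarith
  -- Within `2D/n` of `γ s` the factor `u` changes by at most `2Λ/n`; passing from `u` to `v` costs
  -- another `Λ/n`.
  have hV : ∀ x ∈ perforatedBall D R n, ‖x - z‖ ≤ D / n → |v x| ≤ u (γ s) + 3 * (Λ / n) := by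
    intro x hx hxz
    rw [abs_of_nonneg (zero_le_one.trans (hv1 x hx))]
    have e1 := (abs_le.1 (huv x hx)).2
    have e2 := (le_abs_self _).trans (hLip x (γ s))
    have e3 : ‖x - γ s‖ ≤ 2 * (D / n) := by
      have := norm_add_le (x - z) (z - γ s)
      rw [sub_add_sub_cancel] at this
      linarith
    have e4 := mul_le_mul_of_nonneg_left e3 hK
    linarith
  -- The pieces have length at most `D/(8n)` and `2D/n² ≤ D/(8n)`, so `z` and `w` are within the
  -- required `D/(4n)`.
  refine (intrinsicDist_perforatedBall_le_of_near hD hR hn (by linarith) hV).trans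
    (ENNReal.ofReal_le_ofReal ?_)
  have hu0 : 0 ≤ u (γ s) := zero_le_one.trans (hu1 _)
  have hΛn0 : 0 ≤ Λ / n := by positivity
  have hΛn : Λ / n ≤ Λ := div_le_self (by positivity) (by linarith)
  have hδ := norm_nonneg (γ t - γ s)
  have g1 : (u (γ s) + 3 * (Λ / n)) * (‖(w : E3) - z‖ + 2 * (D / (n : ℝ) ^ 2)) ≤
      (u (γ s) + 3 * (Λ / n)) * (‖γ t - γ s‖ + 4 * (D / (n : ℝ) ^ 2)) :=
    mul_le_mul_of_nonneg_left (by linarith) (by positivity)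
  have g2 : (u (γ s) + 3 * (Λ / n)) * (4 * (D / (n : ℝ) ^ 2)) ≤ 4 * Λ * (4 * (D / (n : ℝ) ^ 2)) :=
    mul_le_mul_of_nonneg_right (by linarith [huΛ (γ s)]) (by positivity)
  have g3 : 3 * (Λ / n) * ‖γ t - γ s‖ ≤ 3 * (Λ / n) * F :=
    mul_le_mul_of_nonneg_left k1 (by positivity)
  have g4 : Λ / D * (D / n / 8) * F ≤ Λ / n * F := by
    have : Λ / D * (D / n / 8) = Λ / n / 8 := by rw [← hKh]; ring
    rw [this]
    have : 0 ≤ F := hδ.trans k1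
    exact mul_le_mul_of_nonneg_right (by linarith) this
  have g5 : 4 * Λ / n = 4 * (Λ / n) := by ring
  rw [g5]
  linarith

/-- Induction on the number of pieces. The endpoint `w` is any point near `γ t`, so the hypothesis
applies to a pushed-out cut point, and adjacent pieces then share that point. -/
lemma intrinsicDist_perforatedBall_le_of_chain (hD : 0 < D) (hR : √3 * D < R) (hn : 16 ≤ n)
    (hΛ : 1 ≤ Λ) (hu1 : ∀ x, 1 ≤ u x) (huΛ : ∀ x, u x ≤ Λ)
    (hLip : ∀ x y, |u x - u y| ≤ Λ / D * ‖x - y‖)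
    (hv1 : ∀ x ∈ perforatedBall D R n, 1 ≤ v x)
    (huv : ∀ x ∈ perforatedBall D R n, |v x - u x| ≤ Λ / n)
    {γ : ℝ → E3} (h : IsPiecewiseSmooth γ) (hfin : pathLength (conformalMetric u) γ ≠ ⊤)
    (hγ : MapsTo γ (Icc 0 1) (Metric.ball 0 R)) {z : perforatedBall D R n} (hz : γ 0 = z) (m : ℕ) :
    ∀ t ∈ Icc (0 : ℝ) 1, ∫ x in (0 : ℝ)..t, realSpeed u γ x ≤ m * (D / n / 8) →
      ∀ w : perforatedBall D R n, ‖(w : E3) - γ t‖ ≤ D / (n : ℝ) ^ 2 →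
      intrinsicDist (perforatedBall D R n) (conformalMetric v) z w ≤
        ENNReal.ofReal ((1 + 4 * Λ / n) * (∫ x in (0 : ℝ)..t, realSpeed u γ x) +
          (m + 1) * (16 * Λ * (D / (n : ℝ) ^ 2))) := by
  have hn16 : (16 : ℝ) ≤ n := by exact_mod_cast hn
  have hr : 0 < D / (n : ℝ) ^ 2 := radius_pos hD (by omega)
  have hh : 0 < D / n := by positivity
  have hu := continuous_of_abs_sub_le hLip
  induction m with
  | zero =>
    intro t ht hl w hw
    refine (intrinsicDist_perforatedBall_le_of_piece hD hR hn hΛ hu1 huΛ hLip hv1 huv h hfin le_rfl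
      ht.1 ht.2 (hl.trans ?_) (by simpa [hz] using hr.le) hw).trans (le_of_eq ?_)
    · simp only [Nat.cast_zero, zero_mul]; positivity
    · simp
  | succ m ih =>
    intro t ht hl w hw
    by_cases hm : ∫ x in (0 : ℝ)..t, realSpeed u γ x ≤ m * (D / n / 8)
    · refine (ih t ht hm w hw).trans (ENNReal.ofReal_le_ofReal ?_)
      push_cast
      have : 0 ≤ 16 * Λ * (D / (n : ℝ) ^ 2) := by positivity
      linarith
    · push Not at hm
      have hi := intervalIntegrable_realSpeed hu h hfin le_rfl ht.1 ht.2
      have hcont : ContinuousOn (fun s => ∫ x in (0 : ℝ)..s, realSpeed u γ x) (Icc 0 t) := by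
        have := intervalIntegral.continuousOn_primitive_interval
          ((intervalIntegrable_iff_integrableOn_Icc_of_le ht.1).1 hi |>.mono_set
            (by rw [uIcc_of_le ht.1]))
        rwa [uIcc_of_le ht.1] at this
      -- Cut where the accumulated length is exactly `m` times the step; the remainder is then at
      -- most one step long.
      obtain ⟨s, hs, hsm⟩ := intermediate_value_Icc ht.1 hcont
        (show (m : ℝ) * (D / n / 8) ∈ Icc (∫ x in (0 : ℝ)..0, realSpeed u γ x)
          (∫ x in (0 : ℝ)..t, realSpeed u γ x) from
          ⟨by rw [intervalIntegral.integral_same]; positivity, hm.le⟩)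
      simp only at hsm
      have hs1 := hs.2.trans ht.2
      have hadd := intervalIntegral.integral_add_adjacent_intervals
        (intervalIntegrable_realSpeed hu h hfin le_rfl hs.1 hs1)
        (intervalIntegrable_realSpeed hu h hfin hs.1 hs.2 ht.2)
      obtain ⟨s', hs'U, hs'⟩ := exists_mem_perforatedBall_norm_sub_le (n := n) hD hR (by omega)
        (hγ ⟨hs.1, hs1⟩)
      have h1 := ih s ⟨hs.1, hs1⟩ hsm.le ⟨s', hs'U⟩ hs'
      push_cast at hl ⊢
      have h2 := intrinsicDist_perforatedBall_le_of_piece hD hR hn hΛ hu1 huΛ hLip hv1 huv h hfin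
        hs.1 hs.2 ht.2 (by linarith) (z := ⟨s', hs'U⟩) hs' hw
      refine (intrinsicDist_triangle _ _ _ ⟨s', hs'U⟩ _).trans ((add_le_add h1 h2).trans ?_)
      have p1 : 0 ≤ ∫ x in (0 : ℝ)..s, realSpeed u γ x :=
        intervalIntegral.integral_nonneg hs.1 fun x _ => realSpeed_nonneg u γ x
      have p2 : 0 ≤ ∫ x in s..t, realSpeed u γ x :=
        intervalIntegral.integral_nonneg hs.2 fun x _ => realSpeed_nonneg u γ x
      rw [← ENNReal.ofReal_add (by positivity) (by positivity), ← hadd]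
      refine ENNReal.ofReal_le_ofReal (le_of_eq ?_)
      ring

/-- Paths of length at least `4RΛ` are harmless, since this already bounds the distance in the
perforated ball. For shorter ones the number of pieces is controlled and the errors of the chain can
be summed. -/
lemma intrinsicDist_perforatedBall_le_add (hD : 0 < D) (hR : √3 * D < R) (hn : 16 ≤ n)
    (hΛ : 1 ≤ Λ) (hu1 : ∀ x, 1 ≤ u x) (huΛ : ∀ x, u x ≤ Λ)
    (hLip : ∀ x y, |u x - u y| ≤ Λ / D * ‖x - y‖)
    (hv1 : ∀ x ∈ perforatedBall D R n, 1 ≤ v x) (hvΛ : ∀ x ∈ perforatedBall D R n, v x ≤ Λ)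
    (huv : ∀ x ∈ perforatedBall D R n, |v x - u x| ≤ Λ / n) (x y : perforatedBall D R n) :
    intrinsicDist (perforatedBall D R n) (conformalMetric v) x y ≤
      intrinsicDist (Metric.ball 0 R) (conformalMetric u)
        ⟨x, perforatedBall_subset D R n x.2⟩ ⟨y, perforatedBall_subset D R n y.2⟩ +
      ENNReal.ofReal (560 * Λ ^ 2 * R / n) := by
  have hn16 : (16 : ℝ) ≤ n := by exact_mod_cast hn
  have hr : 0 < D / (n : ℝ) ^ 2 := radius_pos hD (by omega)
  have hh : 0 < D / n := by positivity
  have hu := continuous_of_abs_sub_le hLip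
  have hDR : D ≤ R := by
    have : 1 ≤ √3 := Real.one_le_sqrt.2 (by norm_num)
    nlinarith
  have hR0 : 0 < R := by linarith
  rw [← tsub_le_iff_right]
  refine le_intrinsicDist fun γ h1 h2 h3 h4 => ?_
  rw [tsub_le_iff_right]
  have hcrude : intrinsicDist (perforatedBall D R n) (conformalMetric v) x y ≤
      ENNReal.ofReal (4 * R * Λ) := by
    refine (intrinsicDist_perforatedBall_le hD hR (by omega) (V := Λ) (fun z hz => by
      rw [abs_of_nonneg (zero_le_one.trans (hv1 z hz))]; exact hvΛ z hz) x y).trans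
        (ENNReal.ofReal_le_ofReal ?_)
    have := norm_sub_le_of_mem_ball (perforatedBall_subset D R n x.2)
      (perforatedBall_subset D R n y.2)
    nlinarith
  rcases le_or_gt (ENNReal.ofReal (4 * R * Λ)) (pathLength (conformalMetric u) γ) with hT | hT
  · exact hcrude.trans (hT.trans le_self_add)
  have hfin := hT.ne_top
  have hLeq := ofReal_integral_realSpeed hu h1 hfin
  set L := ∫ t in (0 : ℝ)..1, realSpeed u γ t with hL
  have hL0 : 0 ≤ L := intervalIntegral.integral_nonneg zero_le_one fun x _ => realSpeed_nonneg u γ x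
  rw [← hLeq] at hT ⊢
  have hLT : L < 4 * R * Λ := (ENNReal.ofReal_lt_ofReal_iff (by positivity)).1 hT
  set m := ⌈L / (D / n / 8)⌉₊
  have hm1 : L ≤ m * (D / n / 8) := by
    rw [← div_le_iff₀ (by positivity)]; exact Nat.le_ceil _
  have hm2 : (m : ℝ) < L / (D / n / 8) + 1 := Nat.ceil_lt_add_one (by positivity)
  have := intrinsicDist_perforatedBall_le_of_chain hD hR hn hΛ hu1 huΛ hLip hv1 huv h1 hfin h2 h3 m
    1 ⟨zero_le_one, le_rfl⟩ hm1 y (by simpa [h4] using hr.le)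
  refine this.trans ?_
  rw [← ENNReal.ofReal_add hL0 (by positivity)]
  refine ENNReal.ofReal_le_ofReal ?_
  have e1 : ((m : ℝ) + 1) * (16 * Λ * (D / (n : ℝ) ^ 2)) ≤
      (L / (D / n / 8) + 2) * (16 * Λ * (D / (n : ℝ) ^ 2)) :=
    mul_le_mul_of_nonneg_right (by linarith) (by positivity)
  have e2 : (L / (D / n / 8) + 2) * (16 * Λ * (D / (n : ℝ) ^ 2)) =
      128 * Λ * L / n + 32 * Λ * (D / (n : ℝ) ^ 2) := by field_simp; ring
  have e3 : D / (n : ℝ) ^ 2 ≤ R / n := by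
    rw [sq, ← div_div]
    have : D / n ≤ R := (div_le_self hD.le (by linarith)).trans hDR
    gcongr
  have e4 : (1 + 4 * Λ / n) * L + (128 * Λ * L / n + 32 * Λ * (R / n)) =
      L + (132 * Λ * L + 32 * Λ * R) / n := by ring
  -- Here `560 = 132 · 4 + 32`, from `L < 4RΛ` and `Λ ≥ 1`.
  have e5 : (132 * Λ * L + 32 * Λ * R) / n ≤ 560 * Λ ^ 2 * R / n := by
    gcongr
    have f1 : 132 * Λ * L ≤ 132 * Λ * (4 * R * Λ) :=
      mul_le_mul_of_nonneg_left hLT.le (by positivity)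
    have f2 : Λ * R ≤ Λ * Λ * R := by
      have : 0 ≤ Λ * R := by positivity
      nlinarith
    nlinarith
  have e6 : 32 * Λ * (D / (n : ℝ) ^ 2) ≤ 32 * Λ * (R / n) :=
    mul_le_mul_of_nonneg_left e3 (by positivity)
  linarith

end Comparison

/-! ### The perforated ball with eight holes -/

lemma norm_sub_boxCenter_one_sq (D : ℝ) (x : E3) (i : Index 1) :
    ‖x - boxCenter D 1 i‖ ^ 2 = ∑ j, (x j - (((i j : ℕ) : ℝ) - 1 / 2) * D) ^ 2 := by
  rw [EuclideanSpace.real_norm_sq_eq]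
  refine Finset.sum_congr rfl fun j _ => ?_
  simp only [boxCenter, PiLp.sub_apply, Nat.cast_one]
  ring

/-- The nearest of the eight centres is the one in the octant of `x`, at squared distance `∑ (|x j|
- D/2)²`. Expanding, only the `ℓ¹` and `ℓ²` norms remain. -/
lemma mem_perforatedBall_one {D R : ℝ} (hD : 0 < D) {x : E3} :
    x ∈ perforatedBall D R 1 ↔ ‖x‖ < R ∧ D ^ 2 / 4 + D * ∑ j, |x j| ≤ ‖x‖ ^ 2 := by
  rw [mem_perforatedBall]
  refine and_congr_right fun _ => ?_
  have hsum : ∑ j, (|x j| - D / 2) ^ 2 = ‖x‖ ^ 2 - D * ∑ j, |x j| + 3 / 4 * D ^ 2 := by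
    rw [EuclideanSpace.real_norm_sq_eq]
    simp only [Fin.sum_univ_three, sub_sq, sq_abs]
    ring
  simp only [Nat.cast_one, one_pow, div_one]
  constructor
  · intro h
    have := h fun j => if 0 ≤ x j then 1 else 0
    have h2 := pow_le_pow_left₀ hD.le this 2
    rw [norm_sub_boxCenter_one_sq] at h2
    have h3 : ∑ j, (x j - ((((if 0 ≤ x j then 1 else 0 : Fin (2 * 1)) : ℕ) : ℝ) - 1 / 2) * D) ^ 2 =
        ∑ j, (|x j| - D / 2) ^ 2 := by
      refine Finset.sum_congr rfl fun j _ => ?_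
      split_ifs with hj
      · rw [abs_of_nonneg hj]; norm_num; ring
      · rw [abs_of_neg (not_le.1 hj)]; norm_num; ring
    rw [h3, hsum] at h2
    linarith
  · intro h i
    refine abs_le_of_sq_le_sq' ?_ (norm_nonneg _) |>.2
    rw [norm_sub_boxCenter_one_sq]
    have h3 : ∑ j, (|x j| - D / 2) ^ 2 ≤ ∑ j, (x j - (((i j : ℕ) : ℝ) - 1 / 2) * D) ^ 2 := by
      refine Finset.sum_le_sum fun j _ => ?_
      have h01 : (i j : ℕ) = 0 ∨ (i j : ℕ) = 1 := by have := (i j).2; omega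
      have a1 := mul_le_mul_of_nonneg_left (le_abs_self (x j)) hD.le
      have a2 := mul_le_mul_of_nonneg_left (neg_abs_le (x j)) hD.le
      rcases h01 with h0 | h0 <;> rw [h0] <;> norm_num <;> nlinarith [sq_abs (x j)]
    linarith

lemma exists_coordinates (k : Fin 3) : ∃ i j : Fin 3, i ≠ k ∧ j ≠ k ∧ i ≠ j ∧
    ∀ f : Fin 3 → ℝ, ∑ l, f l = f k + f i + f j := by
  fin_cases k
  · exact ⟨1, 2, by decide, by decide, by decide, fun f => Fin.sum_univ_three f⟩
  · exact ⟨0, 2, by decide, by decide, by decide, fun f => by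
      rw [Fin.sum_univ_three]; simp only [Fin.mk_one]; ring⟩
  · exact ⟨0, 1, by decide, by decide, by decide, fun f => by
      rw [Fin.sum_univ_three]; simp only [Fin.reduceFinMk]; ring⟩

/-- The scale invariant ratio of `ℓ¹` and `ℓ²` norm decreases if all but the largest coordinate
are scaled down. -/
lemma add_mul_sq_mul_le {a b c s : ℝ} (ha : 0 ≤ a) (hb : 0 ≤ b) (hc : 0 ≤ c) (hba : b ≤ a)
    (hca : c ≤ a) (hs0 : 0 ≤ s) (hs1 : s ≤ 1) :
    (a + s * b + s * c) ^ 2 * (a ^ 2 + b ^ 2 + c ^ 2) ≤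
      (a + b + c) ^ 2 * (a ^ 2 + (s * b) ^ 2 + (s * c) ^ 2) := by
  have hq : b ^ 2 + c ^ 2 ≤ a * (b + c) := by nlinarith
  have hm : 0 ≤ b + c := by positivity
  set m := b + c
  set q := b ^ 2 + c ^ 2 with hqd
  have hqm : q ≤ m ^ 2 := by simp only [m, q]; nlinarith [mul_nonneg hb hc]
  have e0 : 0 ≤ 2 * a ^ 3 * m + a ^ 2 * (m ^ 2 - q) := by
    have := mul_nonneg (sq_nonneg a) (sub_nonneg.2 hqm)
    positivity
  have e1 : 0 ≤ 2 * a * ((a + m) * (a * m - q)) :=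
    mul_nonneg (by positivity) (mul_nonneg (by positivity) (sub_nonneg.2 hq))
  -- This is exactly the right side minus the left side of the claim, in terms of `m` and `q`.
  have key : 0 ≤ (1 - s) * ((1 - s) * (2 * a ^ 3 * m + a ^ 2 * (m ^ 2 - q)) +
      s * (2 * a * ((a + m) * (a * m - q)))) :=
    mul_nonneg (by linarith) (add_nonneg (mul_nonneg (by linarith) e0) (mul_nonneg hs0 e1))
  have l1 : (a + s * b + s * c) ^ 2 * (a ^ 2 + b ^ 2 + c ^ 2) = (a + s * m) ^ 2 * (a ^ 2 + q) := by
    simp only [m, q]; ring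
  have l2 : (a + b + c) ^ 2 * (a ^ 2 + (s * b) ^ 2 + (s * c) ^ 2) =
      (a + m) ^ 2 * (a ^ 2 + s ^ 2 * q) := by
    simp only [m, q]; ring
  rw [l1, l2]
  nlinarith [key]

lemma norm_normalize_sub_le {a b : E3} (ha : a ≠ 0) (hb : b ≠ 0) :
    ‖‖a‖⁻¹ • a - ‖b‖⁻¹ • b‖ ≤ 2 * ‖a - b‖ / ‖a‖ := by
  have ha' := norm_pos_iff.2 ha
  have hb' := norm_pos_iff.2 hb
  have e : ‖a‖⁻¹ • a - ‖b‖⁻¹ • b = ‖a‖⁻¹ • (a - b) + (‖a‖⁻¹ - ‖b‖⁻¹) • b := by module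
  rw [e]
  refine (norm_add_le _ _).trans ?_
  rw [norm_smul, norm_smul, norm_inv, norm_norm, Real.norm_eq_abs, inv_sub_inv ha'.ne' hb'.ne',
    abs_div, abs_of_pos (mul_pos ha' hb')]
  have h1 := abs_norm_sub_norm_le b a
  rw [norm_sub_rev] at h1
  have e2 : |‖b‖ - ‖a‖| / (‖a‖ * ‖b‖) * ‖b‖ = |‖b‖ - ‖a‖| / ‖a‖ := by field_simp
  rw [e2, inv_mul_eq_div, ← add_div]
  gcongr
  linarith

section EightHoles

variable {D R V : ℝ} {v : E3 → ℝ}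

lemma intrinsicDist_one_le_of_segment (hD : 0 < D)
    (hV : ∀ x ∈ perforatedBall D R 1, |v x| ≤ V) {x y : perforatedBall D R 1}
    (h : ∀ t ∈ Icc (0 : ℝ) 1, D ^ 2 / 4 + D * ∑ j, |((x : E3) + t • ((y : E3) - x)) j| ≤
      ‖(x : E3) + t • ((y : E3) - x)‖ ^ 2) :
    intrinsicDist (perforatedBall D R 1) (conformalMetric v) x y ≤ ENNReal.ofReal (2 * (V * R)) := by
  have hs : segment ℝ (x : E3) y ⊆ perforatedBall D R 1 := by
    intro q hq
    rw [mem_perforatedBall_one hD]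
    refine ⟨by simpa using (convex_ball (0 : E3) R).segment_subset x.2.1 y.2.1 hq, ?_⟩
    rw [segment_eq_image'] at hq
    obtain ⟨t, ht, rfl⟩ := hq
    exact h t ht
  refine (intrinsicDist_le_of_segment hs fun q hq => hV q (hs hq)).trans
    (ENNReal.ofReal_le_ofReal ?_)
  have hV0 : 0 ≤ V := (abs_nonneg _).trans (hV x x.2)
  have := mul_le_mul_of_nonneg_left (norm_sub_le_of_mem_ball x.2.1 y.2.1) hV0
  linarith

/-- Every point is joined to a coordinate axis by an arc along which the `ℓ¹` norm decreases. -/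
lemma exists_intrinsicDist_axis_le (hD : 0 < D)
    (hV : ∀ x ∈ perforatedBall D R 1, |v x| ≤ V) (x : perforatedBall D R 1) :
    ∃ (k : Fin 3) (σ ρ : ℝ) (_ : |σ| = 1) (_ : 0 < ρ)
      (h : EuclideanSpace.single k (σ * ρ) ∈ perforatedBall D R 1),
      intrinsicDist (perforatedBall D R 1) (conformalMetric v) x ⟨_, h⟩ ≤
        ENNReal.ofReal (8 * (V * R)) := by
  obtain ⟨k, hk⟩ := Finite.exists_max fun j => |(x : E3) j|
  obtain ⟨hxR, hxD⟩ := (mem_perforatedBall_one hD).1 x.2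
  obtain ⟨i, j, hik, hjk, -, hsum⟩ := exists_coordinates k
  have hV0 : 0 ≤ V := (abs_nonneg _).trans (hV x x.2)
  set ρ := ‖(x : E3)‖ with hρ
  set a := |(x : E3) k| with ha
  have hρ2 : ρ ^ 2 = a ^ 2 + |(x : E3) i| ^ 2 + |(x : E3) j| ^ 2 := by
    rw [hρ, EuclideanSpace.real_norm_sq_eq, hsum]; simp only [sq_abs, ha]
  have hi := hk i
  have hj := hk j
  have hi0 := abs_nonneg ((x : E3) i)
  have hj0 := abs_nonneg ((x : E3) j)
  have ha00 : 0 ≤ a := abs_nonneg _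
  have hρ0 : 0 < ρ := by
    have : 0 < ρ ^ 2 := by
      refine lt_of_lt_of_le ?_ hxD
      have : 0 ≤ ∑ j, |(x : E3) j| := Finset.sum_nonneg fun _ _ => abs_nonneg _
      positivity
    exact lt_of_le_of_ne (norm_nonneg _) fun h0 => by rw [← h0] at this; simp at this
  have hρa : ρ ≤ 2 * a := by
    refine abs_le_of_sq_le_sq' ?_ (by positivity) |>.2
    nlinarith
  have ha0 : 0 < a := by linarith
  have hxk : (x : E3) k ≠ 0 := abs_pos.1 ha0
  let e : E3 := EuclideanSpace.single k ((x : E3) k) - x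
  let w : ℝ → E3 := fun t => (x : E3) + t • e
  have hwk : ∀ t, w t k = (x : E3) k := fun t => by simp [w, e]
  have hwj : ∀ t l, l ≠ k → w t l = (1 - t) * (x : E3) l := fun t l hl => by
    simp [w, e, hl]; ring
  have hw0 : ∀ t, w t ≠ 0 := fun t h0 => hxk (by rw [← hwk t, h0]; rfl)
  have hwa : ∀ t, a ≤ ‖w t‖ := fun t => by
    have := PiLp.norm_apply_le (w t) k
    rwa [hwk] at this
  have he : ‖e‖ ≤ 2 * ρ := by
    have h1 := norm_sub_le (EuclideanSpace.single k ((x : E3) k)) (x : E3)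
    have h2 := PiLp.norm_apply_le (x : E3) k
    rw [PiLp.norm_single] at h1
    linarith
  -- The smaller coordinates shrink linearly along `w`, and normalising keeps the path on the sphere
  -- through `x`. There membership only asks that the `ℓ¹` norm not grow, which is
  -- `add_mul_sq_mul_le`.
  let γ : ℝ → E3 := fun t => ρ • (‖w t‖⁻¹ • w t)
  have hγ0 : γ 0 = x := by
    simp only [γ, w, zero_smul, add_zero]
    rw [← hρ, smul_smul, mul_inv_cancel₀ hρ0.ne', one_smul]
  have hγ1 : γ 1 = EuclideanSpace.single k ((x : E3) k / a * ρ) := by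
    have : w 1 = EuclideanSpace.single k ((x : E3) k) := by simp [w, e]
    simp only [γ]
    rw [this, PiLp.norm_single, Real.norm_eq_abs, ← ha]
    ext l
    by_cases hl : l = k
    · subst hl; simp; ring
    · simp [hl]
  have hγU : MapsTo γ (Icc 0 1) (perforatedBall D R 1) := by
    intro t ht
    have hnorm : ‖γ t‖ = ρ := by
      simp only [γ]
      rw [norm_smul, norm_inv_norm_smul (hw0 t), mul_one, Real.norm_of_nonneg hρ0.le]
    rw [mem_perforatedBall_one hD, hnorm]
    refine ⟨hxR, le_trans (add_le_add le_rfl (mul_le_mul_of_nonneg_left ?_ hD.le)) hxD⟩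
    have hs : 0 ≤ 1 - t := by linarith [ht.2]
    have hwpos : 0 < ‖w t‖ := norm_pos_iff.2 (hw0 t)
    have h1 : ∑ l, |γ t l| = ρ * ‖w t‖⁻¹ * (a + (1 - t) * |(x : E3) i| + (1 - t) * |(x : E3) j|) := by
      rw [hsum fun l => |γ t l|]
      simp only [γ, PiLp.smul_apply, smul_eq_mul, abs_mul, hwk, hwj t i hik, hwj t j hjk,
        abs_of_nonneg hs, abs_of_pos hρ0, abs_of_pos (inv_pos.2 hwpos)]
      ring
    have h2 : ‖w t‖ ^ 2 = a ^ 2 + ((1 - t) * |(x : E3) i|) ^ 2 + ((1 - t) * |(x : E3) j|) ^ 2 := by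
      rw [EuclideanSpace.real_norm_sq_eq, hsum, hwk, hwj t i hik, hwj t j hjk]
      simp only [mul_pow, sq_abs, ha]
    have h3 := add_mul_sq_mul_le ha00 hi0 hj0 hi hj hs (by linarith [ht.1])
    rw [← h2, ← hρ2, ← mul_pow, ← mul_pow] at h3
    have h4 := abs_le_of_sq_le_sq' h3 (by positivity) |>.2
    rw [h1, hsum fun l => |(x : E3) l|]
    have : ρ * ‖w t‖⁻¹ * (a + (1 - t) * |(x : E3) i| + (1 - t) * |(x : E3) j|) =
        (a + (1 - t) * |(x : E3) i| + (1 - t) * |(x : E3) j|) * ρ / ‖w t‖ := by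
      field_simp
    rw [this, div_le_iff₀ hwpos]
    exact h4
  have hsmooth : ContDiff ℝ ∞ γ := by
    have hwd : ContDiff ℝ ∞ w := by fun_prop
    exact (((hwd.norm ℝ hw0).inv fun t => norm_ne_zero_iff.2 (hw0 t)).smul hwd).const_smul ρ
  -- The derivative is bounded by a Lipschitz constant: normalisation contributes `2 / ‖w‖`, with
  -- `‖w‖ ≥ a` and `‖e‖ ≤ 2ρ ≤ 4a`.
  have hd : ∀ t, ‖deriv γ t‖ ≤ 8 * R := by
    intro t
    have hR0 : 0 ≤ R := hρ0.le.trans hxR.le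
    refine (norm_deriv_le_of_lip' (f := γ) (x₀ := t) (C := 8 * ρ) (by positivity)
      (Eventually.of_forall fun s => ?_)).trans (by linarith)
    have h1 : γ s - γ t = ρ • (‖w s‖⁻¹ • w s - ‖w t‖⁻¹ • w t) := by simp only [γ]; module
    have h2 : w s - w t = (s - t) • e := by simp only [w]; module
    rw [h1, norm_smul, Real.norm_of_nonneg hρ0.le]
    have h3 := norm_normalize_sub_le (hw0 s) (hw0 t)
    rw [h2, norm_smul] at h3
    have h4 : 2 * (‖s - t‖ * ‖e‖) / ‖w s‖ ≤ 8 * ‖s - t‖ := by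
      rw [div_le_iff₀ (ha0.trans_le (hwa s))]
      have h5 : ‖s - t‖ * ‖e‖ ≤ ‖s - t‖ * (4 * a) :=
        mul_le_mul_of_nonneg_left (by linarith) (norm_nonneg _)
      have h6 := mul_le_mul_of_nonneg_left (hwa s) (norm_nonneg (s - t))
      linarith
    have := mul_le_mul_of_nonneg_left (h3.trans h4) hρ0.le
    linarith
  have hmem : EuclideanSpace.single k ((x : E3) k / a * ρ) ∈ perforatedBall D R 1 := by
    rw [← hγ1]; exact hγU ⟨zero_le_one, le_rfl⟩
  refine ⟨k, (x : E3) k / a, ρ, ?_, hρ0, hmem, ?_⟩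
  · rw [abs_div, abs_of_pos ha0, ← ha, div_self ha0.ne']
  · refine (intrinsicDist_le_of_norm_deriv_le (.of_contDiffOn hsmooth.contDiffOn) hγU hγ0 hγ1
      (fun t ht => hV _ (hγU ht)) fun t _ => hd t).trans (le_of_eq ?_)
    congr 1; ring

lemma sq_lt_of_sqrt_three (hD : 0 < D) (hR : √3 * D < R) : 3 * D ^ 2 < R ^ 2 := by
  have := pow_lt_pow_left₀ hR (by positivity) two_ne_zero
  rwa [mul_pow, Real.sq_sqrt (by norm_num)] at this

lemma norm_lt_of_sq_le (hD : 0 < D) (hR : √3 * D < R) {x : E3} (h : ‖x‖ ^ 2 ≤ 3 * D ^ 2) :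
    ‖x‖ < R := by
  have hR0 : 0 ≤ R := (by positivity : 0 ≤ √3 * D).trans hR.le
  exact lt_of_pow_lt_pow_left₀ 2 hR0 (h.trans_lt (sq_lt_of_sqrt_three hD hR))

lemma sum_abs_single (k : Fin 3) (c : ℝ) :
    ∑ j, |(EuclideanSpace.single k c : E3) j| = |c| := by
  rw [Finset.sum_eq_single k (fun j _ hj => by simp [hj]) (by simp)]
  simp

/-- The base points of the half-axes. The number `17/10` lies below `√3`, so the point is in the
ball, and clears the holes as `1/4 + 1.7 ≤ 1.7²`. -/
lemma single_mem_perforatedBall (hD : 0 < D) (hR : √3 * D < R) (k : Fin 3) {σ : ℝ} (hσ : |σ| = 1) :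
    EuclideanSpace.single k (σ * (17 / 10 * D)) ∈ perforatedBall D R 1 := by
  have h1 : |σ * (17 / 10 * D)| = 17 / 10 * D := by
    rw [abs_mul, hσ, one_mul, abs_of_pos (by positivity)]
  rw [mem_perforatedBall_one hD, sum_abs_single, h1]
  have h2 : ‖(EuclideanSpace.single k (σ * (17 / 10 * D)) : E3)‖ = 17 / 10 * D := by
    rw [PiLp.norm_single, Real.norm_eq_abs, h1]
  exact ⟨norm_lt_of_sq_le hD hR (by rw [h2]; nlinarith [sq_nonneg D]),
    by rw [h2]; nlinarith [sq_nonneg D]⟩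

/-- On a half-axis the holes are avoided when `ρ² - Dρ ≥ D²/4`; this forces `ρ ≥ D`, where the left
side is increasing, so the segment between two admissible points is admissible. -/
lemma intrinsicDist_single_single_le (hD : 0 < D) (hR : √3 * D < R)
    (hV : ∀ x ∈ perforatedBall D R 1, |v x| ≤ V) {k : Fin 3} {σ ρ : ℝ} (hσ : |σ| = 1) (hρ : 0 < ρ)
    (h : EuclideanSpace.single k (σ * ρ) ∈ perforatedBall D R 1) :
    intrinsicDist (perforatedBall D R 1) (conformalMetric v) ⟨_, h⟩
      ⟨_, single_mem_perforatedBall hD hR k hσ⟩ ≤ ENNReal.ofReal (2 * (V * R)) := by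
  refine intrinsicDist_one_le_of_segment hD hV fun t ht => ?_
  have he : EuclideanSpace.single k (σ * ρ) + t • (EuclideanSpace.single k (σ * (17 / 10 * D)) -
      EuclideanSpace.single k (σ * ρ)) =
      (EuclideanSpace.single k (σ * (ρ + t * (17 / 10 * D - ρ))) : E3) := by
    ext l
    by_cases hl : l = k
    · subst hl; simp; ring
    · simp [hl]
  simp only
  rw [he, sum_abs_single, PiLp.norm_single, Real.norm_eq_abs, abs_mul, hσ, one_mul]
  have h2 := ((mem_perforatedBall_one hD).1 h).2
  rw [sum_abs_single, PiLp.norm_single, Real.norm_eq_abs, abs_mul, hσ, one_mul,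
    abs_of_pos hρ] at h2
  have hρD : D ≤ ρ := by
    by_contra! hc
    nlinarith
  set c := ρ + t * (17 / 10 * D - ρ) with hc
  rcases le_total ρ (17 / 10 * D) with hle | hle
  · have h3 : ρ ≤ c := by
      have := mul_nonneg ht.1 (sub_nonneg.2 hle); linarith
    rw [abs_of_pos (by linarith)]
    nlinarith [mul_nonneg (sub_nonneg.2 h3) (by linarith : 0 ≤ c + ρ - D)]
  · have h3 : 17 / 10 * D ≤ c := by
      have := mul_nonneg (sub_nonneg.2 ht.2) (sub_nonneg.2 hle); linarith
    rw [abs_of_pos (by linarith)]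
    nlinarith [mul_nonneg (sub_nonneg.2 h3) (by linarith : 0 ≤ c + 17 / 10 * D - D), sq_nonneg D]

/-- The corner with two coordinates `±6D/5` is a stopover between two half-axes: its squared norm
`2.88 D²` is below `3D²`, and it clears the holes as `1/4 + 2.4 ≤ 2.88`. -/
lemma corner_mem_and_dist_le (hD : 0 < D) (hR : √3 * D < R)
    (hV : ∀ x ∈ perforatedBall D R 1, |v x| ≤ V) {k l : Fin 3} (hkl : k ≠ l) {σ τ : ℝ}
    (hσ : |σ| = 1) (hτ : |τ| = 1) :
    ∃ h : EuclideanSpace.single k (σ * (6 / 5 * D)) + EuclideanSpace.single l (τ * (6 / 5 * D)) ∈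
        perforatedBall D R 1,
      intrinsicDist (perforatedBall D R 1) (conformalMetric v)
        ⟨_, single_mem_perforatedBall hD hR k hσ⟩ ⟨_, h⟩ ≤ ENNReal.ofReal (2 * (V * R)) := by
  have hσ2 : σ ^ 2 = 1 := by rw [← sq_abs, hσ, one_pow]
  have hτ2 : τ ^ 2 = 1 := by rw [← sq_abs, hτ, one_pow]
  obtain ⟨i, j, hik, hjk, hij, hsum⟩ := exists_coordinates k
  have key : ∀ a b : ℝ, ∑ m, |(EuclideanSpace.single k a + EuclideanSpace.single l b : E3) m| =
      |a| + |b| ∧ ‖(EuclideanSpace.single k a + EuclideanSpace.single l b : E3)‖ ^ 2 =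
      a ^ 2 + b ^ 2 := by
    intro a b
    rw [EuclideanSpace.real_norm_sq_eq, hsum, hsum]
    have hl : l = i ∨ l = j := by omega
    rcases hl with rfl | rfl
    · simp [hkl, hkl.symm, hij.symm, hjk]
    · simp [hkl, hkl.symm, hij, hik]
  have hc : 0 ≤ 6 / 5 * D := by positivity
  have hmem : EuclideanSpace.single k (σ * (6 / 5 * D)) +
      EuclideanSpace.single l (τ * (6 / 5 * D)) ∈ perforatedBall D R 1 := by
    obtain ⟨k1, k2⟩ := key (σ * (6 / 5 * D)) (τ * (6 / 5 * D))
    rw [mem_perforatedBall_one hD, k1]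
    rw [abs_mul σ, abs_mul τ, hσ, hτ, abs_of_nonneg hc]
    refine ⟨norm_lt_of_sq_le hD hR ?_, ?_⟩ <;> rw [k2, mul_pow σ, mul_pow τ, hσ2, hτ2] <;>
      nlinarith [sq_nonneg D]
  refine ⟨hmem, intrinsicDist_one_le_of_segment hD hV fun t ht => ?_⟩
  have he : EuclideanSpace.single k (σ * (17 / 10 * D)) +
      t • (EuclideanSpace.single k (σ * (6 / 5 * D)) + EuclideanSpace.single l (τ * (6 / 5 * D)) -
        EuclideanSpace.single k (σ * (17 / 10 * D))) =
      (EuclideanSpace.single k (σ * ((17 / 10 - t / 2) * D)) +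
        EuclideanSpace.single l (τ * (6 / 5 * t * D)) : E3) := by
    ext m
    by_cases hm : m = k
    · subst hm; simp [hkl]; ring
    · by_cases hm' : m = l
      · subst hm'; simp [hm]; ring
      · simp [hm, hm']
  simp only
  obtain ⟨k1, k2⟩ := key (σ * ((17 / 10 - t / 2) * D)) (τ * (6 / 5 * t * D))
  rw [he, k1, k2, abs_mul σ, abs_mul τ, hσ, hτ, mul_pow σ, mul_pow τ, hσ2, hτ2,
    abs_of_nonneg (mul_nonneg (by linarith [ht.2]) hD.le),
    abs_of_nonneg (mul_nonneg (by linarith [ht.1]) hD.le)]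
  -- Along the segment the margin is `D² (1.69 t² - 2.4 t + 0.94)`; completing the square shows that
  -- it is positive.
  have : 0 ≤ D ^ 2 * (169 / 100 * (t - 120 / 169) ^ 2) := by positivity
  nlinarith [sq_nonneg D]

lemma intrinsicDist_axis_axis_le (hD : 0 < D) (hR : √3 * D < R)
    (hV : ∀ x ∈ perforatedBall D R 1, |v x| ≤ V) {k l : Fin 3} (hkl : k ≠ l) {σ τ : ℝ}
    (hσ : |σ| = 1) (hτ : |τ| = 1) :
    intrinsicDist (perforatedBall D R 1) (conformalMetric v)
        ⟨_, single_mem_perforatedBall hD hR k hσ⟩ ⟨_, single_mem_perforatedBall hD hR l hτ⟩ ≤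
      ENNReal.ofReal (4 * (V * R)) := by
  obtain ⟨h1, h2⟩ := corner_mem_and_dist_le hD hR hV hkl hσ hτ
  obtain ⟨h3, h4⟩ := corner_mem_and_dist_le hD hR hV hkl.symm hτ hσ
  have hsub : (⟨_, h3⟩ : perforatedBall D R 1) = ⟨_, h1⟩ := Subtype.ext (add_comm _ _)
  rw [intrinsicDist_comm, hsub] at h4
  have hR0 : 0 ≤ R := (by positivity : 0 ≤ √3 * D).trans hR.le
  have hV0 : 0 ≤ V := (abs_nonneg _).trans (hV _ h1)
  refine (intrinsicDist_triangle _ _ _ ⟨_, h1⟩ _).trans ((add_le_add h2 h4).trans (le_of_eq ?_))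
  rw [← ENNReal.ofReal_add (by positivity) (by positivity)]
  congr 1; ring

lemma intrinsicDist_perforatedBall_one_le (hD : 0 < D) (hR : √3 * D < R)
    (hV : ∀ x ∈ perforatedBall D R 1, |v x| ≤ V) (x y : perforatedBall D R 1) :
    intrinsicDist (perforatedBall D R 1) (conformalMetric v) x y ≤
      ENNReal.ofReal (28 * (V * R)) := by
  have hR0 : 0 ≤ R := (by positivity : 0 ≤ √3 * D).trans hR.le
  have hV0 : 0 ≤ V := (abs_nonneg _).trans (hV x x.2)
  have hVR := mul_nonneg hV0 hR0
  have key : ∀ x : perforatedBall D R 1, ∃ (k : Fin 3) (σ : ℝ) (hσ : |σ| = 1),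
      intrinsicDist (perforatedBall D R 1) (conformalMetric v) x
        ⟨_, single_mem_perforatedBall hD hR k hσ⟩ ≤ ENNReal.ofReal (10 * (V * R)) := by
    intro x
    obtain ⟨k, σ, ρ, hσ, hρ, h, hd⟩ := exists_intrinsicDist_axis_le hD hV x
    refine ⟨k, σ, hσ, (intrinsicDist_triangle _ _ _ ⟨_, h⟩ _).trans ((add_le_add hd
      (intrinsicDist_single_single_le hD hR hV hσ hρ h)).trans (le_of_eq ?_))⟩
    rw [← ENNReal.ofReal_add (by positivity) (by positivity)]
    congr 1; ring
  obtain ⟨k, σ, hσ, hx⟩ := key x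
  obtain ⟨l, τ, hτ, hy⟩ := key y
  -- The route through a third axis also handles `k = l`, in particular opposite half-axes. The
  -- total is `10 + 4 + 4 + 10 = 28`.
  obtain ⟨m, hmk, hml⟩ : ∃ m : Fin 3, k ≠ m ∧ m ≠ l := by
    have : ∀ k l : Fin 3, ∃ m : Fin 3, k ≠ m ∧ m ≠ l := by decide
    exact this k l
  rw [intrinsicDist_comm] at hy
  have h1 := intrinsicDist_axis_axis_le hD hR hV hmk hσ (abs_one (α := ℝ))
  have h2 := intrinsicDist_axis_axis_le hD hR hV hml (abs_one (α := ℝ)) hτ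
  refine (intrinsicDist_triangle _ _ _ _ _).trans ((add_le_add hx
    ((intrinsicDist_triangle _ _ _ _ _).trans (add_le_add h1
      ((intrinsicDist_triangle _ _ _ _ _).trans (add_le_add h2 hy))))).trans (le_of_eq ?_))
  rw [← ENNReal.ofReal_add (by positivity) (by positivity),
    ← ENNReal.ofReal_add (by positivity) (by positivity),
    ← ENNReal.ofReal_add (by positivity) (by positivity)]
  congr 1; ring

end EightHoles

/-! ### The Gromov–Hausdorff estimate -/

lemma perforatedBall_nonempty {D R : ℝ} {n : ℕ} (hD : 0 < D) (hR : √3 * D < R) (hn : 1 ≤ n) :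
    (perforatedBall D R n).Nonempty := by
  rcases eq_or_lt_of_le hn with rfl | hn2
  · exact ⟨_, single_mem_perforatedBall hD hR 0 (abs_one (α := ℝ))⟩
  · have hR0 : 0 < R := (by positivity : 0 ≤ √3 * D).trans_lt hR
    obtain ⟨x, hx, -⟩ := exists_mem_perforatedBall_norm_sub_le (n := n) hD hR hn2
      (Metric.mem_ball_self hR0)
    exact ⟨x, hx⟩

lemma ghDist_perforatedBall_le {D R : ℝ} {n : ℕ} {u v : E3 → ℝ} {Λ : ℝ} (hD : 0 < D)
    (hR : √3 * D < R) (hn : 1 ≤ n)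
    (hΛ : 1 ≤ Λ) (hu1 : ∀ x, 1 ≤ u x) (huΛ : ∀ x, u x ≤ Λ)
    (hLip : ∀ x y, |u x - u y| ≤ Λ / D * ‖x - y‖)
    (hv1 : ∀ x ∈ perforatedBall D R n, 1 ≤ v x) (hvΛ : ∀ x ∈ perforatedBall D R n, v x ≤ Λ)
    (huv : ∀ x ∈ perforatedBall D R n, |v x - u x| ≤ Λ / n) :
    ghDist (intrinsicDist (perforatedBall D R n) (conformalMetric v))
        (intrinsicDist (Metric.ball 0 R) (conformalMetric u)) ≤
      ENNReal.ofReal (1120 * Λ ^ 2 * R / n) := by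
  have hn1 : (1 : ℝ) ≤ n := by exact_mod_cast hn
  have hDR : D ≤ R := by
    have : 1 ≤ √3 := Real.one_le_sqrt.2 (by norm_num)
    nlinarith
  have hR0 : 0 < R := hD.trans_le hDR
  have hu0 : ∀ x, 0 ≤ u x := fun x => zero_le_one.trans (hu1 x)
  have huΛ' : ∀ x, |u x| ≤ Λ := fun x => by rw [abs_of_nonneg (hu0 x)]; exact huΛ x
  have hvΛ' : ∀ x ∈ perforatedBall D R n, |v x| ≤ Λ := fun x hx => by
    rw [abs_of_nonneg (zero_le_one.trans (hv1 x hx))]; exact hvΛ x hx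
  have hΛR : 0 ≤ Λ * R := by positivity
  have hΛΛ : Λ * R ≤ Λ ^ 2 * R := by nlinarith
  set ε := 560 * Λ ^ 2 * R / n with hε
  have hε0 : 0 < ε := by positivity
  have hεeq : 1120 * Λ ^ 2 * R / n = 2 * ε := by rw [hε]; ring
  have hdu : ∀ x y : Metric.ball (0 : E3) R,
      intrinsicDist (Metric.ball 0 R) (conformalMetric u) x y ≤ ENNReal.ofReal (2 * (Λ * R)) := by
    intro x y
    refine (intrinsicDist_ball_le huΛ' x y).trans (ENNReal.ofReal_le_ofReal ?_)
    have := mul_le_mul_of_nonneg_left (norm_sub_le_of_mem_ball x.2 y.2) (by linarith : 0 ≤ Λ)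
    linarith
  have hdv : ∀ x y : perforatedBall D R n,
      intrinsicDist (perforatedBall D R n) (conformalMetric v) x y ≤
        ENNReal.ofReal (28 * (Λ * R)) := by
    intro x y
    rcases eq_or_lt_of_le hn with rfl | hn2
    · exact intrinsicDist_perforatedBall_one_le hD hR hvΛ' x y
    · refine (intrinsicDist_perforatedBall_le hD hR hn2 hvΛ' x y).trans
        (ENNReal.ofReal_le_ofReal ?_)
      have := mul_le_mul_of_nonneg_left (norm_sub_le_of_mem_ball
        (perforatedBall_subset D R n x.2) (perforatedBall_subset D R n y.2)) (by linarith : 0 ≤ Λ)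
      linarith
  have hufin := fun x y => ((hdu x y).trans_lt ENNReal.ofReal_lt_top).ne
  have hvfin := fun x y => ((hdv x y).trans_lt ENNReal.ofReal_lt_top).ne
  have hne := perforatedBall_nonempty hD hR hn
  rw [hεeq]
  rcases le_or_gt 16 n with h16 | h16
  · refine ghDist_le_of_subset (perforatedBall_subset D R n) hne (fun x _ => hu1 x) hv1 hufin hvfin
      hε0 (intrinsicDist_perforatedBall_le_add hD hR h16 hΛ hu1 huΛ hLip hv1 hvΛ huv)
      (fun x y => ?_) fun y => ?_
    · refine (intrinsicDist_ball_le_mul hn hΛ hv1 hu0 huv x y).trans ?_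
      -- The diameter bound turns the relative error `Λ/n` into an additive one.
      rw [ENNReal.ofReal_add zero_le_one (by positivity), add_mul, ENNReal.ofReal_one, one_mul]
      refine add_le_add le_rfl ((mul_le_mul_right (hdv x y) _).trans ?_)
      rw [← ENNReal.ofReal_mul (by positivity)]
      refine ENNReal.ofReal_le_ofReal ?_
      have : Λ / n * (28 * (Λ * R)) = 28 * Λ ^ 2 * R / n := by ring
      rw [this, hε]
      gcongr
      norm_num
    · obtain ⟨x, hx, hxy⟩ := exists_mem_perforatedBall_norm_sub_le (n := n) hD hR (by omega) y.2
      refine ⟨⟨x, hx⟩, (intrinsicDist_ball_le huΛ' _ _).trans (ENNReal.ofReal_le_ofReal ?_)⟩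
      refine (mul_le_mul_of_nonneg_left hxy (by linarith)).trans ?_
      have e1 : D / (n : ℝ) ^ 2 ≤ R / n := by
        rw [sq, ← div_div]
        have : D / n ≤ R := (div_le_self hD.le hn1).trans hDR
        gcongr
      refine (mul_le_mul_of_nonneg_left e1 (by linarith)).trans ?_
      rw [← mul_div_assoc, hε]
      gcongr
      nlinarith
  · have hn16 : (n : ℝ) ≤ 16 := by exact_mod_cast h16.le
    -- For `n ≤ 16` one has `560 / n ≥ 35 > 28`, so `ε` exceeds both diameters and any single point
    -- approximates the whole ball.
    have hεbig : 28 * (Λ * R) ≤ ε := by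
      rw [hε, le_div_iff₀ (by linarith)]
      have : 28 * (Λ * R) * n ≤ 28 * (Λ * R) * 16 :=
        mul_le_mul_of_nonneg_left hn16 (by positivity)
      nlinarith
    have hv' := fun x y => (hdv x y).trans (ENNReal.ofReal_le_ofReal hεbig)
    have hu' := fun x y => (hdu x y).trans (ENNReal.ofReal_le_ofReal (by linarith : _ ≤ ε))
    obtain ⟨x, hx⟩ := hne
    exact ghDist_le_of_subset (perforatedBall_subset D R n) ⟨x, hx⟩ (fun x _ => hu1 x) hv1 hufin
      hvfin hε0 (fun x y => (hv' x y).trans le_add_self) (fun x y => (hu' _ _).trans le_add_self)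
      fun y => ⟨⟨x, hx⟩, hu' _ _⟩

/-! ### The control constant -/

/-- The sum of `1` and the control variables. -/
noncomputable def controlSum (D : ℝ) (A B : E3 → ℝ) (α β : (n : ℕ) → Index n → ℝ) : ℝ :=
  1 + ∑ i, controlVars D A B α β i

lemma controlSum_eq (D : ℝ) (A B : E3 → ℝ) (α β : (n : ℕ) → Index n → ℝ) :
    controlSum D A B α β = 1 + (supNorm A * D ^ 2 + supNorm B * D ^ 2 + supNormDeriv A * D ^ 3 +
      supNormDeriv B * D ^ 3 + sampleConst D A α / D + sampleConst D B β / D) := by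
  simp [controlSum, controlVars, Fin.sum_univ_six]

/-- A universal polynomial with value `K (1 + ∑ cᵢ)⁴ R`. -/
noncomputable def universalPoly (K : ℝ≥0) : ControlPoly :=
  Polynomial.C (MvPolynomial.C K * (1 + ∑ i, MvPolynomial.X i) ^ 4) * Polynomial.X

lemma universalPoly_value (K : ℝ≥0) (c : Fin 6 → ℝ) (R : ℝ) :
    (universalPoly K).value c R = K * (1 + ∑ i, c i) ^ 4 * R := by
  rw [universalPoly, ControlPoly.value, Polynomial.eval₂_mul, Polynomial.eval₂_C,
    Polynomial.eval₂_X]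
  simp

lemma abs_mul_sub_mul_le {a b a' b' ca cb da db : ℝ} (hb : 0 ≤ b) (ha' : 0 ≤ a') (hca : b ≤ ca)
    (hcb : a' ≤ cb) (hda : |a - a'| ≤ da) (hdb : |b - b'| ≤ db) :
    |a * b - a' * b'| ≤ da * ca + cb * db := by
  have e : a * b - a' * b' = (a - a') * b + a' * (b - b') := by ring
  rw [e]
  refine (abs_add_le _ _).trans (add_le_add ?_ ?_)
  · rw [abs_mul, abs_of_nonneg hb]
    exact mul_le_mul hda hca hb ((abs_nonneg _).trans hda)
  · rw [abs_mul, abs_of_nonneg ha']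
    exact mul_le_mul hcb hdb (abs_nonneg _) (ha'.trans hcb)

lemma ghDist_discreteMetric_le {D R : ℝ} (hD : 0 < D) (hR : √3 * D < R) {A B : E3 → ℝ}
    {α β : (n : ℕ) → Index n → ℝ} (hA : IsDensity D A) (hB : IsDensity D B)
    (hα : IsAdmissible D A α) (hβ : IsAdmissible D B β) {n : ℕ} (hn : 1 ≤ n) :
    ghDist (intrinsicDist (perforatedBall D R n) (discreteMetric D α β n))
        (intrinsicDist (Metric.ball 0 R) (limitMetric A B)) ≤
      ENNReal.ofReal (1120 * (10 ^ 5 * controlSum D A B α β ^ 2) ^ 2 * R / n) := by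
  have hn1 : (1 : ℝ) ≤ n := by exact_mod_cast hn
  set s := controlSum D A B α β with hs
  rw [controlSum_eq] at hs
  have a1 : 0 ≤ supNorm A * D ^ 2 := mul_nonneg (supNorm_nonneg A) (by positivity)
  have a2 : 0 ≤ supNorm B * D ^ 2 := mul_nonneg (supNorm_nonneg B) (by positivity)
  have a3 : 0 ≤ supNormDeriv A * D ^ 3 := mul_nonneg (supNormDeriv_nonneg A) (by positivity)
  have a4 : 0 ≤ supNormDeriv B * D ^ 3 := mul_nonneg (supNormDeriv_nonneg B) (by positivity)
  have a5 : 0 ≤ sampleConst D A α / D := div_nonneg (sampleConst_nonneg D A α) hD.le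
  have a6 : 0 ≤ sampleConst D B β / D := div_nonneg (sampleConst_nonneg D B β) hD.le
  have hs1 : 1 ≤ s := by linarith
  have hs2 : 1 ≤ s ^ 2 := one_le_pow₀ hs1
  have hχ : ∀ x, limitFactor A x ≤ 31 * s := fun x => by
    linarith [hA.limitFactor_le hD x]
  have hψ : ∀ x, limitFactor B x ≤ 31 * s := fun x => by
    linarith [hB.limitFactor_le hD x]
  have hχ1 := hA.one_le_limitFactor
  have hψ1 := hB.one_le_limitFactor
  have hχL : ∀ x y, |limitFactor A x - limitFactor A y| ≤ 46 * s / D * ‖x - y‖ := fun x y => by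
    refine (hA.abs_limitFactor_sub_le hD x y).trans ?_
    gcongr; linarith
  have hψL : ∀ x y, |limitFactor B x - limitFactor B y| ≤ 46 * s / D * ‖x - y‖ := fun x y => by
    refine (hB.abs_limitFactor_sub_le hD x y).trans ?_
    gcongr; linarith
  have hχn : ∀ x ∈ perforatedBall D R n,
      |discreteFactor D α n x - limitFactor A x| ≤ 235 * s / n := fun x hx => by
    refine (abs_discreteFactor_sub_limitFactor_le hD hA hα hn (mem_perforatedBall.1 hx).2).trans ?_
    gcongr; linarith
  have hψn : ∀ x ∈ perforatedBall D R n,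
      |discreteFactor D β n x - limitFactor B x| ≤ 235 * s / n := fun x hx => by
    refine (abs_discreteFactor_sub_limitFactor_le hD hB hβ hn (mem_perforatedBall.1 hx).2).trans ?_
    gcongr; linarith
  have hsn : 235 * s / n ≤ 235 * s := div_le_self (by positivity) hn1
  have hχn' : ∀ x ∈ perforatedBall D R n, discreteFactor D α n x ≤ 266 * s := fun x hx => by
    linarith [(abs_le.1 (hχn x hx)).2, hχ x]
  have hψn' : ∀ x ∈ perforatedBall D R n, discreteFactor D β n x ≤ 266 * s := fun x hx => by
    linarith [(abs_le.1 (hψn x hx)).2, hψ x]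
  have hχn1 := hα.one_le_discreteFactor n
  have hψn1 := hβ.one_le_discreteFactor n
  -- Here `Λ = 10⁵ s²`, which dominates every coefficient of `s²` below: `31²` and `266²` for the
  -- sizes of the products, `2852` for the Lipschitz constant, `69795` for the difference.
  refine ghDist_perforatedBall_le hD hR hn (by linarith) (fun x => ?_) (fun x => ?_)
    (fun x y => ?_) (fun x _ => ?_) (fun x hx => ?_) (fun x hx => ?_)
  · exact one_le_mul_of_one_le_of_one_le (hχ1 x) (hψ1 x)
  · refine (mul_le_mul (hχ x) (hψ x) (by linarith [hψ1 x]) (by positivity)).trans ?_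
    nlinarith
  · refine (abs_mul_sub_mul_le (by linarith [hψ1 x]) (by linarith [hχ1 y]) (hψ x) (hχ y) (hχL x y)
      (hψL x y)).trans ?_
    have e : 46 * s / D * ‖x - y‖ * (31 * s) + 31 * s * (46 * s / D * ‖x - y‖) =
      2852 * s ^ 2 / D * ‖x - y‖ := by ring
    rw [e]
    gcongr
    norm_num
  · exact one_le_mul_of_one_le_of_one_le (hχn1 x) (hψn1 x)
  · refine (mul_le_mul (hχn' x hx) (hψn' x hx) (by linarith [hψn1 x]) (by positivity)).trans ?_
    nlinarith
  · refine (abs_mul_sub_mul_le (by linarith [hψn1 x]) (by linarith [hχ1 x]) (hψn' x hx) (hχ x)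
      (hχn x hx) (hψn x hx)).trans ?_
    have e : 235 * s / n * (266 * s) + 31 * s * (235 * s / n) = 69795 * s ^ 2 / n := by ring
    rw [e]
    gcongr
    norm_num

end BrillLindquist

theorem mainTheorem5 :
    ∃ P : BrillLindquist.ControlPoly,
      ∀ (D R : ℝ) (A B : BrillLindquist.E3 → ℝ)
        (α β : (n : ℕ) → BrillLindquist.Index n → ℝ),
        0 < D → √3 * D < R →
        BrillLindquist.IsDensity D A → BrillLindquist.IsDensity D B →
        BrillLindquist.IsAdmissible D A α → BrillLindquist.IsAdmissible D B β →
        Tendsto (fun n : ℕ => BrillLindquist.ghDist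
            (BrillLindquist.intrinsicDist (BrillLindquist.perforatedBall D R n)
              (BrillLindquist.discreteMetric D α β n))
            (BrillLindquist.intrinsicDist (Metric.ball 0 R) (BrillLindquist.limitMetric A B)))
          atTop (𝓝 0) ∧
        ∀ n : ℕ, 1 ≤ n →
          BrillLindquist.ghDist
            (BrillLindquist.intrinsicDist (BrillLindquist.perforatedBall D R n)
              (BrillLindquist.discreteMetric D α β n))
            (BrillLindquist.intrinsicDist (Metric.ball 0 R) (BrillLindquist.limitMetric A B))
          ≤ ENNReal.ofReal
              (P.value (BrillLindquist.controlVars D A B α β) R / (n : ℝ)) := by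
  -- The bound `1120 Λ² R / n` with `Λ = 10⁵ s²` has numerator `1120 · 10¹⁰ s⁴ R`, a polynomial of
  -- the required kind.
  refine ⟨BrillLindquist.universalPoly (1120 * 10 ^ 10), fun D R A B α β hD hR hA hB hα hβ => ?_⟩
  have hbound : ∀ n : ℕ, 1 ≤ n → BrillLindquist.ghDist
      (BrillLindquist.intrinsicDist (BrillLindquist.perforatedBall D R n)
        (BrillLindquist.discreteMetric D α β n))
      (BrillLindquist.intrinsicDist (Metric.ball 0 R) (BrillLindquist.limitMetric A B)) ≤
      ENNReal.ofReal ((BrillLindquist.universalPoly (1120 * 10 ^ 10)).value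
        (BrillLindquist.controlVars D A B α β) R / (n : ℝ)) := by
    intro n hn
    refine (BrillLindquist.ghDist_discreteMetric_le hD hR hA hB hα hβ hn).trans (le_of_eq ?_)
    rw [BrillLindquist.universalPoly_value, BrillLindquist.controlSum]
    congr 2
    push_cast
    ring
  refine ⟨?_, hbound⟩
  have hlim := ENNReal.tendsto_ofReal (tendsto_const_div_atTop_nhds_zero_nat
    ((BrillLindquist.universalPoly (1120 * 10 ^ 10)).value
      (BrillLindquist.controlVars D A B α β) R))
  rw [ENNReal.ofReal_zero] at hlim
  exact tendsto_of_tendsto_of_tendsto_of_le_of_le' tendsto_const_nhds hlim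
    (Eventually.of_forall fun _ => zero_le) ((eventually_ge_atTop 1).mono hbound)
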